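/- Fix a field $F$ and an integer $r\ge 0$. A weighted graph $(G,f)$ is a finite simple graph $G=(V,E)$ with a function $f:E\to\mathbb R$. Write $N_H(v)$ for the set consisting of $v$ and its neighbors in a graph $H$, and, for $t\in\mathbb R$, $G_t$ for the subgraph of $G$ induced by the edges $e$ with $f(e)\le t$ (its vertices are the endpoints of these edges). A set $Y$ of vertices of a graph $H$ is enclaveless in $H$ if $N_H(v)\subseteq Y$ for no $v\in Y$. Consider three simplicial complexes: $Cl(G)$, the nonempty cliques of $G$; $Nb(G)$, the nonempty subsets of the sets $N_G(v)$, $v\in V$; $El(G)$, the nonempty enclaveless sets of $G$. Filtering functions $f_K:K(G)\to\mathbb R\cup\{+\infty\}$ for $K=Cl,Nb,El$ are defined as follows. For a $0$-simplex, $f_K(\langle v\rangle)$ is the minimum of $f$ on the edges incident on $v$ ($+\infty$ if there is none). For a simplex $\sigma$ with at least two vertices, $f_{Cl}(\sigma)$ is the maximum of $f$ on the edges joining vertices of $\sigma$; $f_{Nb}(\sigma)$ is the smallest $t$ such that $\sigma\subseteq N_{G_t}(w)$ for some vertex $w$ of $G_t$; $f_{El}(\sigma)$ is the smallest $t$ such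 that $\sigma$ is contained in an enclaveless set of $G_t$. For a filtered complex $(X,g)$, with sublevel complexes $X_u=\{\sigma : g(\sigma)\le u\}$, $u\in\mathbb R$, let $\beta(u,v)=\dim\operatorname{Im}\big(H_r(X_u;F)\to H_r(X_v;F)\big)$ for $u<v$ (simplicial homology). The $r$-th persistence diagram of $(X,g)$ is the multiset consisting of - each point $(u,v)$ with $u<v$ real, with multiplicity $\min\{\beta(u+\varepsilon,v-\varepsilon)-\beta(u-\varepsilon,v-\varepsilon)-\beta(u+\varepsilon,v+\varepsilon)+\beta(u-\varepsilon,v+\varepsilon) : \varepsilon>0,\ u+\varepsilon<v-\varepsilon\}$; - each point at infinity $(u,\infty)$, with multiplicity $\min\{\beta(u+\varepsilon,1/\varepsilon)-\beta(u-\varepsilon,1/\varepsilon) : \varepsilon>0,\ u+\varepsilon<1/\varepsilon\}$; - each diagonal point $(u,u)$, with countably infinite multiplicity. The bottleneck distance of two such diagrams is $d(D,D')=\inf_\sigma\sup_{P\in D}\hat d(P,\sigma(P))$, where $\sigma$ varies among all bijections $D\to D'$ (counting multiplicities) and $$\hat d((u,v),(u',v'))=\min\Big\{\max\{|u-u'|,|v-v'|\},\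 \max\big\{\tfrac{v-u}{2},\tfrac{v'-u'}{2}\big\}\Big\},\qquad |\infty-\infty|=0 .$$ The natural pseudodistance of weighted graphs is $\delta((G,f),(G',f'))=\min_\psi\max_{e\in E(G)}|f(e)-f'(\psi(e))|$, where $\psi$ varies among all graph isomorphisms $G\to G'$ (the maximum is $0$ if $G$ has no edges), and $\delta=+\infty$ if $G$ and $G'$ are not isomorphic. **Proposition.** Let $(G,f)$ and $(G',f')$ be weighted graphs, let $K$ be one of $Cl$, $Nb$, $El$, and let $D(f)$, $D(f')$ be the $r$-th persistence diagrams of $(K(G),f_K)$ and $(K(G'),f'_K)$. Then $$d\big(D(f),D(f')\big)\le\delta\big((G,f),(G',f')\big).$$ -/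

import Mathlib

open scoped ENNReal

noncomputable section

namespace GraphPersistence

/-! ### Filtered simplicial complexes and their persistent Betti numbers -/

/-- A filtered simplicial complex with vertices in `V`: a simplicial complex together with a
filtering function on its simplices which never decreases from a face to a larger simplex.
Its vertices are the `v` for which `{v}` is a simplex; the value of `value` outside `complex` is
irrelevant. The value `⊤` means that the simplex enters no sublevel complex. -/
structure FilteredComplex (V : Type*) where
  complex : PreAbstractSimplicialComplex V
  value : Finset V → EReal
  mono : ∀ σ ∈ complex, ∀ τ ∈ complex, τ ⊆ σ → value τ ≤ value σ

/-- The sublevel complex of all simplices with value at most `u`. -/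
def FilteredComplex.sublevel {V : Type*} (X : FilteredComplex V) (u : ℝ) :
    PreAbstractSimplicialComplex V where
  faces := {σ | σ ∈ X.complex ∧ X.value σ ≤ (u : EReal)}
  isRelLowerSet_faces := by
    rintro σ ⟨hσ, hu⟩
    refine ⟨(X.complex.isRelLowerSet_faces hσ).1, fun τ hτσ hτ => ?_⟩
    have h := (X.complex.isRelLowerSet_faces hσ).2 hτσ hτ
    exact ⟨h, (X.mono σ hσ τ h hτσ).trans hu⟩

theorem FilteredComplex.sublevel_mono {V : Type*} (X : FilteredComplex V) {u v : ℝ}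
    (h : u ≤ v) : X.sublevel u ≤ X.sublevel v :=
  fun _ hσ => ⟨hσ.1, hσ.2.trans (EReal.coe_le_coe_iff.2 h)⟩

/-- Formal `F`-linear combinations of `n`-tuples of elements of `V`. -/
def TupleSpace (F : Type*) [Field F] (V : Type*) (n : ℕ) : Type _ := (Fin n → V) →₀ F

instance (F : Type*) [Field F] (V : Type*) (n : ℕ) : AddCommGroup (TupleSpace F V n) :=
  inferInstanceAs (AddCommGroup ((Fin n → V) →₀ F))

instance (F : Type*) [Field F] (V : Type*) (n : ℕ) : Module F (TupleSpace F V n) :=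
  inferInstanceAs (Module F ((Fin n → V) →₀ F))

/-- The boundary `(v₀, …, vₙ) ↦ ∑ᵢ (-1)ⁱ (v₀, …, v̂ᵢ, …, vₙ)` on formal combinations of
tuples. -/
def boundary (F : Type*) [Field F] (V : Type*) (n : ℕ) :
    TupleSpace F V (n + 1) →ₗ[F] TupleSpace F V n :=
  Finsupp.linearCombination F (M := (Fin n → V) →₀ F)
    (fun x => ∑ i : Fin (n + 1), Finsupp.single (fun j => x (i.succAbove j)) ((-1 : F) ^ (i : ℕ)))

/-- The ordered `n`-chains of `K`: formal combinations of `(n+1)`-tuples of vertices of a common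
simplex. -/
def chains (F : Type*) [Field F] {V : Type*} (K : PreAbstractSimplicialComplex V) (n : ℕ) :
    Submodule F (TupleSpace F V (n + 1)) :=
  Finsupp.supported F F {x | ∃ σ ∈ K, ∀ i, x i ∈ σ}

/-- The `n`-cycles of `K`; every `0`-chain is a cycle. -/
def cycles (F : Type*) [Field F] {V : Type*} (K : PreAbstractSimplicialComplex V) :
    (n : ℕ) → Submodule F (TupleSpace F V (n + 1))
  | 0 => chains F K 0
  | n + 1 => chains F K (n + 1) ⊓ LinearMap.ker (boundary F V (n + 1))

/-- The `n`-boundaries of `K`. -/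
def boundaries (F : Type*) [Field F] {V : Type*} (K : PreAbstractSimplicialComplex V) (n : ℕ) :
    Submodule F (TupleSpace F V (n + 1)) :=
  (chains F K (n + 1)).map (boundary F V (n + 1))

/-- The simplicial homology `Hₙ(K; F)`, computed by the ordered chain complex. -/
abbrev Homology (F : Type*) [Field F] {V : Type*} (K : PreAbstractSimplicialComplex V) (n : ℕ) :
    Type _ :=
  cycles F K n ⧸ (boundaries F K n).submoduleOf (cycles F K n)

theorem chains_mono (F : Type*) [Field F] {V : Type*} {K L : PreAbstractSimplicialComplex V}
    (h : K ≤ L) (n : ℕ) : chains F K n ≤ chains F L n :=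
  Finsupp.supported_mono fun _ ⟨σ, hσ, hx⟩ => ⟨σ, h hσ, hx⟩

theorem cycles_mono (F : Type*) [Field F] {V : Type*} {K L : PreAbstractSimplicialComplex V}
    (h : K ≤ L) (n : ℕ) : cycles F K n ≤ cycles F L n := by
  cases n with
  | zero => exact chains_mono F h 0
  | succ n => exact inf_le_inf_right _ (chains_mono F h (n + 1))

theorem boundaries_mono (F : Type*) [Field F] {V : Type*} {K L : PreAbstractSimplicialComplex V}
    (h : K ≤ L) (n : ℕ) : boundaries F K n ≤ boundaries F L n :=
  Submodule.map_mono (chains_mono F h (n + 1))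

/-- The linear map `Hₙ(K; F) → Hₙ(L; F)` induced by the inclusion of a subcomplex `K` of `L`. -/
def homologyMap (F : Type*) [Field F] {V : Type*} {K L : PreAbstractSimplicialComplex V}
    (h : K ≤ L) (n : ℕ) : Homology F K n →ₗ[F] Homology F L n :=
  Submodule.mapQ _ _ (Submodule.inclusion (cycles_mono F h n))
    (fun _ hx => boundaries_mono F h n hx)

/-- The persistent Betti number function
`β(u, v) = dim Im (H_r(X_u) → H_r(X_v))` of a filtered complex, for `u < v` (and `0` outside this
half-plane, where it is not considered). -/
def pbn (F : Type*) [Field F] {V : Type*} (X : FilteredComplex V) (r : ℕ) (u v : ℝ) : ℕ :=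
  if h : u < v then
    Module.finrank F (LinearMap.range (homologyMap F (X.sublevel_mono h.le) r))
  else 0

/-! ### Persistence diagrams and the bottleneck distance -/

/-- The multiplicity of the proper point `(u, v)`, `u < v`: the minimum over `ε > 0` with
`u + ε < v - ε` of `β(u+ε, v-ε) - β(u-ε, v-ε) - β(u+ε, v+ε) + β(u-ε, v+ε)`. -/
def properMultiplicity (β : ℝ → ℝ → ℕ) (u v : ℝ) : ℕ :=
  sInf {m : ℕ | ∃ ε : ℝ, 0 < ε ∧ u + ε < v - ε ∧
    (m : ℤ) = (β (u + ε) (v - ε) : ℤ) - β (u - ε) (v - ε) - β (u + ε) (v + ε)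
      + β (u - ε) (v + ε)}

/-- The multiplicity of the point at infinity `(u, ∞)`, i.e. of the vertical half-line at `u`:
the minimum over `ε > 0` with `u + ε < 1/ε` of `β(u+ε, 1/ε) - β(u-ε, 1/ε)`. -/
def infiniteMultiplicity (β : ℝ → ℝ → ℕ) (u : ℝ) : ℕ :=
  sInf {m : ℕ | ∃ ε : ℝ, 0 < ε ∧ u + ε < 1 / ε ∧
    (m : ℤ) = (β (u + ε) (1 / ε) : ℤ) - β (u - ε) (1 / ε)}

open Classical in
/-- The multiplicity of a point `(u, v)`, `u ∈ ℝ`, `v ∈ [-∞, ∞]`, in the persistence diagram of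
`β`. Points of the diagonal have infinite multiplicity and points below it multiplicity `0`; the
cornerpoints, proper or at infinity, are the points above the diagonal with positive
multiplicity. -/
def multiplicity (β : ℝ → ℝ → ℕ) (p : ℝ × EReal) : ℕ∞ :=
  if p.2 = (p.1 : EReal) then ⊤
  else if p.2 = ⊤ then (infiniteMultiplicity β p.1 : ℕ∞)
  else if (p.1 : EReal) < p.2 then (properMultiplicity β p.1 p.2.toReal : ℕ∞)
  else 0

/-- The persistence diagram of `β`, completed by the diagonal, as a multiset: its elements are the
pairs `(p, k)` where `k` numbers the copies of the point `p`. -/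
def Diagram (β : ℝ → ℝ → ℕ) : Type :=
  {x : (ℝ × EReal) × ℕ // (x.2 : ℕ∞) < multiplicity β x.1}

/-- `|a - b|` for extended reals, with `|∞ - ∞| = 0`. -/
def extDist (a b : EReal) : ℝ≥0∞ :=
  open Classical in if a = b then 0 else (a - b).abs

/-- `min {max {|u - u'|, |v - v'|}, max {(v - u)/2, (v' - u')/2}}`. -/
def pointDist (p q : ℝ × EReal) : ℝ≥0∞ :=
  min (max (extDist p.1 q.1) (extDist p.2 q.2))
    (max ((p.2 - p.1).toENNReal / 2) ((q.2 - q.1).toENNReal / 2))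

/-- The bottleneck distance of the persistence diagrams of `β` and `β'`. -/
def bottleneckDist (β β' : ℝ → ℝ → ℕ) : ℝ≥0∞ :=
  ⨅ σ : Diagram β ≃ Diagram β', ⨆ P : Diagram β, pointDist P.1.1 (σ P).1.1

/-! ### Weighted graphs -/

section Graph

variable {V : Type*} (G : SimpleGraph V)

/-- The natural pseudodistance of weighted graphs; it is `∞` if the graphs are not isomorphic. -/
def naturalPseudodist {V V' : Type*} (G : SimpleGraph V) (f : G.edgeSet → ℝ)
    (G' : SimpleGraph V') (f' : G'.edgeSet → ℝ) : ℝ≥0∞ :=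
  ⨅ ψ : G ≃g G', ⨆ e : G.edgeSet, ENNReal.ofReal |f e - f' (ψ.mapEdgeSet e)|

/-- The minimum of `f` on the edges incident on `v` (`⊤` if there are none). -/
def vertexValue (f : G.edgeSet → ℝ) (v : V) : EReal :=
  ⨅ (e : G.edgeSet) (_ : v ∈ e.1), (f e : EReal)

/-- The subgraph `G_t` induced by all edges `e` with `f e ≤ t`. -/
def sublevelGraph (f : G.edgeSet → ℝ) (t : ℝ) : G.Subgraph where
  verts := {v | ∃ e : G.edgeSet, f e ≤ t ∧ v ∈ e.1}
  Adj u v := ∃ h : G.Adj u v, f ⟨s(u, v), h⟩ ≤ t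
  adj_sub := fun ⟨h, _⟩ => h
  edge_vert := fun {u v} ⟨h, ht⟩ => ⟨⟨s(u, v), h⟩, ht, Sym2.mem_mk_left u v⟩
  symm := ⟨fun u v ⟨h, ht⟩ => ⟨h.symm, by
    have : (⟨s(v, u), h.symm⟩ : G.edgeSet) = ⟨s(u, v), h⟩ := Subtype.ext Sym2.eq_swap
    rw [this]; exact ht⟩⟩

variable {G}

/-- The neighborhood of `v` in the subgraph `H`, including `v` itself. -/
def closedNeighborhood (H : G.Subgraph) (v : V) : Set V :=
  insert v (H.neighborSet v)

/-- `S` is contained in the neighborhood of some vertex of `H`. -/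
def InNeighborhood (H : G.Subgraph) (S : Set V) : Prop :=
  ∃ w ∈ H.verts, S ⊆ closedNeighborhood H w

/-- A set of vertices of `H` is enclaveless if it contains the neighborhood of none of its
members. -/
def IsEnclaveless (H : G.Subgraph) (S : Set V) : Prop :=
  S ⊆ H.verts ∧ ∀ v ∈ S, ¬ closedNeighborhood H v ⊆ S

variable (G)

/-- The complex of cliques. -/
def cliqueComplex : PreAbstractSimplicialComplex V where
  faces := {σ | σ.Nonempty ∧ G.IsClique (σ : Set V)}
  isRelLowerSet_faces := fun _ hσ =>
    ⟨hσ.1, fun _ hτσ hτ => ⟨hτ, hσ.2.subset (Finset.coe_subset.2 hτσ)⟩⟩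

/-- The complex of neighborhoods. -/
def neighborhoodComplex : PreAbstractSimplicialComplex V where
  faces := {σ | σ.Nonempty ∧ InNeighborhood (⊤ : G.Subgraph) (σ : Set V)}
  isRelLowerSet_faces := fun _ hσ => ⟨hσ.1, fun _ hτσ hτ =>
    ⟨hτ, hσ.2.imp fun _ h => ⟨h.1, (Finset.coe_subset.2 hτσ).trans h.2⟩⟩⟩

theorem IsEnclaveless.subset {G : SimpleGraph V} {H : G.Subgraph} {S T : Set V}
    (h : IsEnclaveless H S) (hTS : T ⊆ S) : IsEnclaveless H T :=
  ⟨hTS.trans h.1, fun v hv hN => h.2 v (hTS hv) (hN.trans hTS)⟩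

/-- The complex of enclaveless sets. -/
def enclavelessComplex : PreAbstractSimplicialComplex V where
  faces := {σ | σ.Nonempty ∧ IsEnclaveless (⊤ : G.Subgraph) (σ : Set V)}
  isRelLowerSet_faces := fun _ hσ =>
    ⟨hσ.1, fun _ hτσ hτ => ⟨hτ, hσ.2.subset (Finset.coe_subset.2 hτσ)⟩⟩

open Classical in
/-- The function which is `vertexValue` on `0`-simplices and `g` on simplices of positive
dimension. -/
def simplexValue (f : G.edgeSet → ℝ) (g : Finset V → EReal) (σ : Finset V) : EReal :=
  if σ.card = 1 then ⨅ v ∈ σ, vertexValue G f v else g σ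

/-- `f_Cl`: on a simplex of positive dimension, the maximum of `f` on the edges spanned by it. -/
def cliqueValue (f : G.edgeSet → ℝ) : Finset V → EReal :=
  simplexValue G f fun σ => ⨆ (e : G.edgeSet) (_ : ∀ v ∈ e.1, v ∈ σ), (f e : EReal)

/-- `f_Nb`: on a simplex of positive dimension, the smallest `t` for which it is a subset of a
neighborhood in `G_t`. -/
def neighborhoodValue (f : G.edgeSet → ℝ) : Finset V → EReal :=
  simplexValue G f fun σ =>
    ⨅ (t : ℝ) (_ : InNeighborhood (sublevelGraph G f t) (σ : Set V)), (t : EReal)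

/-- `f_El`: on a simplex of positive dimension, the smallest `t` for which it is a subset of an
enclaveless set in `G_t`. -/
def enclavelessValue (f : G.edgeSet → ℝ) : Finset V → EReal :=
  simplexValue G f fun σ =>
    ⨅ (t : ℝ) (_ : ∃ S : Set V, (σ : Set V) ⊆ S ∧ IsEnclaveless (sublevelGraph G f t) S),
      (t : EReal)

variable {G}

theorem vertexValue_le {f : G.edgeSet → ℝ} {v : V} (e : G.edgeSet) (h : v ∈ e.1) :
    vertexValue G f v ≤ (f e : EReal) :=
  iInf₂_le e h

theorem vertexValue_le_of_mem_verts {f : G.edgeSet → ℝ} {v : V} {t : ℝ}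
    (h : v ∈ (sublevelGraph G f t).verts) : vertexValue G f v ≤ (t : EReal) := by
  obtain ⟨e, he, hv⟩ := h
  exact (vertexValue_le e hv).trans (EReal.coe_le_coe_iff.2 he)

theorem simplexValue_mono {f : G.edgeSet → ℝ} {g : Finset V → EReal} {σ τ : Finset V}
    (hτ : τ.Nonempty) (hτσ : τ ⊆ σ) (hg : g τ ≤ g σ)
    (hv : 1 < σ.card → ∀ v ∈ σ, vertexValue G f v ≤ g σ) :
    simplexValue G f g τ ≤ simplexValue G f g σ := by
  classical
  have h1 := hτ.card_pos
  have h2 := Finset.card_le_card hτσ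
  unfold simplexValue
  split_ifs with hτ1 hσ1 hσ1
  · rw [Finset.eq_of_subset_of_card_le hτσ (by omega)]
  · obtain ⟨v, rfl⟩ := Finset.card_eq_one.1 hτ1
    simpa using hv (by omega) v (hτσ (by simp))
  · omega
  · exact hg

variable (G)

/-- The filtered complex `(Cl(G), f_Cl)`. -/
def cliqueFiltered (f : G.edgeSet → ℝ) : FilteredComplex V where
  complex := cliqueComplex G
  value := cliqueValue G f
  mono := fun σ hσ τ hτ hτσ => by
    refine simplexValue_mono hτ.1 hτσ
      (iSup_mono fun e => iSup_mono' fun h => ⟨fun v hv => hτσ (h v hv), le_rfl⟩) fun hc v hv => ?_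
    obtain ⟨w, hw, hne⟩ := Finset.exists_mem_ne hc v
    have hadj : G.Adj v w := hσ.2 hv hw hne.symm
    refine (vertexValue_le ⟨s(v, w), hadj⟩ (Sym2.mem_mk_left v w)).trans ?_
    refine le_iSup₂_of_le (⟨s(v, w), hadj⟩ : G.edgeSet) (fun x hx => ?_) le_rfl
    rcases Sym2.mem_iff.1 hx with rfl | rfl <;> assumption

/-- The filtered complex `(Nb(G), f_Nb)`. -/
def neighborhoodFiltered (f : G.edgeSet → ℝ) : FilteredComplex V where
  complex := neighborhoodComplex G
  value := neighborhoodValue G f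
  mono := fun σ hσ τ hτ hτσ => by
    refine simplexValue_mono hτ.1 hτσ (iInf_mono fun t => iInf_mono' fun h =>
      ⟨h.imp fun _ h => ⟨h.1, (Finset.coe_subset.2 hτσ).trans h.2⟩, le_rfl⟩) fun hc v hv => ?_
    refine le_iInf₂ fun t ⟨w, hw, hs⟩ => vertexValue_le_of_mem_verts ?_
    rcases hs hv with rfl | h
    · exact hw
    · exact (sublevelGraph G f t).edge_vert h.symm

/-- The filtered complex `(El(G), f_El)`. -/
def enclavelessFiltered (f : G.edgeSet → ℝ) : FilteredComplex V where
  complex := enclavelessComplex G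
  value := enclavelessValue G f
  mono := fun σ hσ τ hτ hτσ => by
    refine simplexValue_mono hτ.1 hτσ (iInf_mono fun t => iInf_mono' fun h =>
      ⟨h.imp fun _ h => ⟨(Finset.coe_subset.2 hτσ).trans h.1, h.2⟩, le_rfl⟩) fun hc v hv => ?_
    exact le_iInf₂ fun t ⟨S, hs, hS⟩ => vertexValue_le_of_mem_verts (hS.1 (hs hv))

end Graph

end GraphPersistence

end

noncomputable section

namespace GraphPersistence

open Module

/-! ### Ranks of the maps in persistent homology -/

section Rank

variable {F : Type*} [Field F] {V : Type*}

/-! An isomorphism `ψ` whose edge values differ by at most `c` carries each of the three complexes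
onto the other and moves every filtering value by at most `c`: a clique, a neighborhood or an
enclaveless set at threshold `t` becomes one at threshold `t + c`, and the same holds for the
inverse of `ψ`. It remains to prove bottleneck stability for two filtrations of one finite complex
(`matched_realFiltered`, made applicable by `matched_of_equiv`).

Stability is proved by interpolation. If `g` and `g'` never order two simplices in strictly opposite
ways, both are nondecreasing along a common integer rank of the simplices. The integer-indexed
filtration by rank has a barcode (`exists_bars`), because the mixed differences of the ranks of its
homology maps are nonnegative, by dimension counting. The bars of `g` and of `g'` are this one
barcode with ranks replaced by function values (`exists_isBarcode`), so bars with the same index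
have ends at most `c` apart. In general, one moves linearly from `g` towards `g'` until the first
inverted pair is tied; this stretch is concordant, and fewer inversions remain. The costs `s * c`
and `(1 - s) * c` add up to `c` by the triangle inequality `Close.trans`.

The multiplicities defining a diagram are limits of box counts. For a finite barcode they count the
bars with given ends, so a diagram is the set of bars together with countably many copies of each
diagonal point (`IsBarcode.exists_equiv`). -/

instance [Finite V] (n : ℕ) : Module.Finite F (TupleSpace F V n) :=
  inferInstanceAs (Module.Finite F ((Fin n → V) →₀ F))

/-- Rank-nullity for the composite of the cycles of `K` onto `Homology F K n` and on to `Homology F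
L n`. From here on, ranks of homology maps are dimensions of subspaces of one ambient space. -/
theorem finrank_range_homologyMap [Finite V] {K L : PreAbstractSimplicialComplex V} (h : K ≤ L)
    (n : ℕ) :
    finrank F (LinearMap.range (homologyMap F h n))
      + finrank F ↥(cycles F K n ⊓ boundaries F L n) = finrank F (cycles F K n) := by
  have hr : LinearMap.range ((homologyMap F h n) ∘ₗ Submodule.mkQ _)
      = LinearMap.range (homologyMap F h n) :=
    LinearMap.range_comp_of_range_eq_top _ (Submodule.range_mkQ _)
  have hk : LinearMap.ker ((homologyMap F h n) ∘ₗ Submodule.mkQ _)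
      = (boundaries F L n).comap (cycles F K n).subtype := by
    ext x
    change (Submodule.Quotient.mk (Submodule.inclusion (cycles_mono F h n) x) : Homology F L n) = 0
      ↔ _
    rw [Submodule.Quotient.mk_eq_zero]
    rfl
  rw [← hr, ← LinearMap.finrank_range_add_finrank_ker
    ((homologyMap F h n) ∘ₗ Submodule.mkQ ((boundaries F K n).submoduleOf (cycles F K n))), hk,
    ← Submodule.map_comap_subtype, Submodule.finrank_map_subtype_eq]

/-- The subspaces `Z' ⊓ B` and `Z ⊓ B'` have sum inside `Z' ⊓ B'` and intersection inside `Z ⊓ B`.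
With cycles and boundaries this is the nonnegativity of bar multiplicities. -/
theorem finrank_inf_add_finrank_inf_le {M : Type*} [AddCommGroup M] [Module F M]
    [Module.Finite F M] {Z Z' B B' : Submodule F M} (hZ : Z ≤ Z') (hB : B ≤ B') :
    finrank F ↥(Z' ⊓ B) + finrank F ↥(Z ⊓ B')
      ≤ finrank F ↥(Z' ⊓ B') + finrank F ↥(Z ⊓ B) := by
  rw [← Submodule.finrank_sup_add_finrank_inf_eq]
  refine Nat.add_le_add (Submodule.finrank_mono ?_) (Submodule.finrank_mono ?_)
  · exact sup_le (inf_le_inf_left _ hB) (inf_le_inf_right _ hZ)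
  · exact le_inf (inf_le_right.trans inf_le_left) (inf_le_left.trans inf_le_right)

end Rank

/-! ### Bars of a rank function -/

section Bars

open Finset

theorem sum_Ico_sub_succ (h : ℕ → ℤ) {a b : ℕ} (hab : a ≤ b) :
    ∑ j ∈ Ico a b, (h j - h (j + 1)) = h a - h b := by
  induction b, hab using Nat.le_induction with
  | base => simp
  | succ n hn ih => rw [sum_Ico_succ_top hn, ih]; ring

open Classical in
-- Möbius inversion: the mixed difference at `(i, j)` is the number of bars `[i + 1, j + 1)`.
-- Summing over `i < a` and `b ≤ j ≤ N` telescopes twice, and `h0` and `hN` remove the remaining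
-- terms.
theorem exists_bars (s : ℕ → ℕ → ℤ) (N : ℕ) (h0 : ∀ j, s 0 j = 0) (hN : ∀ i, s i (N + 1) = 0)
    (hs : ∀ i j, 0 ≤ s (i + 1) j - s i j - (s (i + 1) (j + 1) - s i (j + 1))) :
    ∃ (ι : Type) (_ : Fintype ι) (p q : ι → ℕ),
      (∀ x, 1 ≤ p x ∧ p x ≤ N ∧ p x < q x) ∧
      ∀ a b, a ≤ b → b ≤ N → s a b = (#{x | p x ≤ a ∧ b < q x} : ℕ) := by
  set m : ℕ → ℕ → ℤ := fun i j => s (i + 1) j - s i j - (s (i + 1) (j + 1) - s i (j + 1)) with hm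
  -- The column `j = N` holds the bars that never die. Pairs with `j ≤ i` can be dropped, since `i <
  -- a ≤ b ≤ j` for every bar counted.
  let I := {y : Fin N × Fin (N + 1) // y.1.1 + 1 ≤ y.2.1}
  refine ⟨Σ y : I, Fin (m y.1.1 y.1.2).toNat, inferInstance, fun x => x.1.1.1 + 1,
    fun x => x.1.1.2 + 1, fun x => ⟨Nat.le_add_left _ _, x.1.1.1.2, Nat.lt_succ_of_le x.1.2⟩,
    fun a b hab hb => ?_⟩
  have h1 : (univ.filter fun x : Σ y : I, Fin (m y.1.1 y.1.2).toNat =>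
        (x.1.1.1 : ℕ) + 1 ≤ a ∧ b < (x.1.1.2 : ℕ) + 1)
      = (univ.filter fun y : I => (y.1.1 : ℕ) + 1 ≤ a ∧ b < (y.1.2 : ℕ) + 1).sigma
          fun _ => univ := by
    ext x; simp
  have h2 : ∑ i ∈ range a, ∑ j ∈ Ico b (N + 1), m i j = s a b := by
    have : ∀ i ∈ range a, ∑ j ∈ Ico b (N + 1), m i j = s (i + 1) b - s i b := fun i _ => by
      rw [hm, sum_Ico_sub_succ (fun j => s (i + 1) j - s i j) (by omega)]; simp [hN]
    rw [sum_congr rfl this, sum_range_sub (fun i => s i b), h0, sub_zero]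
  rw [h1, card_sigma, ← h2, ← sum_product']
  push_cast
  symm
  refine sum_bij (fun y _ => ((y.1.1 : ℕ), (y.1.2 : ℕ))) ?_ ?_ ?_ ?_
  · rintro ⟨⟨i, j⟩, hij⟩ h
    simp only [mem_filter, mem_univ, true_and] at h
    have := j.2
    simp only [mem_product, mem_range, mem_Ico]
    omega
  · rintro ⟨⟨i, j⟩, hij⟩ _ ⟨⟨i', j'⟩, hij'⟩ _ h
    simp only [Prod.mk.injEq] at h
    exact Subtype.ext (Prod.ext (Fin.ext h.1) (Fin.ext h.2))
  · rintro ⟨i, j⟩ h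
    simp only [mem_product, mem_range, mem_Ico] at h
    refine ⟨⟨⟨⟨i, by omega⟩, ⟨j, by omega⟩⟩, by simp; omega⟩, ?_, rfl⟩
    simp; omega
  · rintro ⟨⟨i, j⟩, hij⟩ _
    have := hs i j
    simp only [card_univ, Fintype.card_fin, Int.ofNat_toNat, hm]
    exact max_eq_left this

end Bars

/-! ### Barcodes and persistence diagrams -/

section Barcode

open Finset Filter Topology

/-- The function `β` counts the intervals `[b x, d x)`. -/
def IsBarcode {ι : Type*} [Fintype ι] (β : ℝ → ℝ → ℕ) (b : ι → ℝ) (d : ι → EReal) : Prop :=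
  open Classical in
  -- Empty bars are allowed, so that one index set serves many functions; they lie on the diagonal.
  (∀ x, (b x : EReal) ≤ d x) ∧
    ∀ u v : ℝ, u < v → β u v = #{x | b x ≤ u ∧ (v : EReal) < d x}

variable {ι : Type*} [Fintype ι] {β : ℝ → ℝ → ℕ} {b : ι → ℝ} {d : ι → EReal}

open Classical in
-- Inclusion-exclusion, checked bar by bar.
theorem IsBarcode.box (h : IsBarcode β b d) {u v ε : ℝ} (hε : 0 < ε) (huv : u + ε < v - ε) :
    (β (u + ε) (v - ε) : ℤ) - β (u - ε) (v - ε) - β (u + ε) (v + ε) + β (u - ε) (v + ε)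
      = (#{x | (u - ε < b x ∧ b x ≤ u + ε) ∧ ((v - ε : ℝ) : EReal) < d x ∧
          d x ≤ ((v + ε : ℝ) : EReal)} : ℕ) := by
  rw [h.2 _ _ (by linarith), h.2 _ _ (by linarith), h.2 _ _ (by linarith), h.2 _ _ (by linarith)]
  simp only [card_filter, Nat.cast_sum, ← sum_sub_distrib, ← sum_add_distrib]
  refine sum_congr rfl fun x _ => ?_
  have e1 : b x ≤ u - ε → b x ≤ u + ε := fun h => by linarith
  have e2 : ((v + ε : ℝ) : EReal) < d x → ((v - ε : ℝ) : EReal) < d x :=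
    fun h => lt_of_le_of_lt (EReal.coe_le_coe_iff.2 (by linarith)) h
  have f1 : u - ε < b x ↔ ¬ b x ≤ u - ε := not_le.symm
  have f2 : d x ≤ ((v + ε : ℝ) : EReal) ↔ ¬ ((v + ε : ℝ) : EReal) < d x := not_lt.symm
  simp only [f1, f2]
  by_cases a1 : b x ≤ u - ε <;> by_cases a2 : b x ≤ u + ε <;>
    by_cases a3 : ((v + ε : ℝ) : EReal) < d x <;> by_cases a4 : ((v - ε : ℝ) : EReal) < d x <;>
    first
    | exact absurd (e1 a1) a2
    | exact absurd (e2 a3) a4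
    | simp only [a1, a2, a3, a4, not_true_eq_false, not_false_eq_true, and_true, and_false,
        if_true, if_false, Nat.cast_zero, Nat.cast_one, sub_zero, sub_self, add_zero,
        sub_add_cancel]

open Classical in
theorem IsBarcode.strip (h : IsBarcode β b d) {u w ε : ℝ} (hε : 0 < ε) (huv : u + ε < w) :
    (β (u + ε) w : ℤ) - β (u - ε) w
      = (#{x | (u - ε < b x ∧ b x ≤ u + ε) ∧ (w : EReal) < d x} : ℕ) := by
  rw [h.2 _ _ (by linarith), h.2 _ _ (by linarith)]
  simp only [card_filter, Nat.cast_sum, ← sum_sub_distrib]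
  refine sum_congr rfl fun x _ => ?_
  have e1 : b x ≤ u - ε → b x ≤ u + ε := fun h => by linarith
  have f1 : u - ε < b x ↔ ¬ b x ≤ u - ε := not_le.symm
  simp only [f1]
  by_cases a1 : b x ≤ u - ε <;> by_cases a2 : b x ≤ u + ε <;>
    by_cases a3 : (w : EReal) < d x <;> simp_all

theorem eventually_not_mem_window {a u : ℝ} (h : a ≠ u) :
    ∀ᶠ ε : ℝ in 𝓝[>] 0, ¬ (u - ε < a ∧ a ≤ u + ε) := by
  have : ∀ᶠ ε : ℝ in 𝓝[>] 0, ε < |a - u| :=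
    nhdsWithin_le_nhds (Iio_mem_nhds (abs_pos.2 (sub_ne_zero.2 h)))
  filter_upwards [this] with ε hε ⟨h1, h2⟩
  rcases abs_cases (a - u) with h | h <;> linarith

theorem eventually_not_mem_window_ereal {a : EReal} {u : ℝ} (h : a ≠ u) :
    ∀ᶠ ε : ℝ in 𝓝[>] 0, ¬ (((u - ε : ℝ) : EReal) < a ∧ a ≤ ((u + ε : ℝ) : EReal)) := by
  induction a with
  | bot => simp
  | top => exact Eventually.of_forall fun ε h => absurd h.2 (not_le.2 (EReal.coe_lt_top _))
  | coe a =>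
    simp only [EReal.coe_lt_coe_iff, EReal.coe_le_coe_iff]
    exact eventually_not_mem_window fun h' => h (by rw [h'])

open Classical in
-- Every admissible box contains the bars with ends exactly `(u, v)`. As there are finitely many
-- bars, a small enough box contains no others.
theorem IsBarcode.properMultiplicity_eq (h : IsBarcode β b d) {u v : ℝ} (huv : u < v) :
    properMultiplicity β u v = #{x | b x = u ∧ d x = v} := by
  apply le_antisymm
  · have key : ∀ᶠ ε : ℝ in 𝓝[>] 0, 0 < ε ∧ u + ε < v - ε ∧
        ∀ x, (b x = u ∨ ¬ (u - ε < b x ∧ b x ≤ u + ε)) ∧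
          (d x = v ∨ ¬ (((v - ε : ℝ) : EReal) < d x ∧ d x ≤ ((v + ε : ℝ) : EReal))) := by
      refine eventually_mem_nhdsWithin.and (Eventually.and ?_ (eventually_all.2 fun x => ?_))
      · have : ∀ᶠ ε : ℝ in 𝓝[>] 0, ε < (v - u) / 2 :=
          nhdsWithin_le_nhds (Iio_mem_nhds (by linarith))
        filter_upwards [this] with ε hε using by linarith
      · refine Eventually.and ?_ ?_
        · by_cases hx : b x = u
          · simp [hx]
          · exact (eventually_not_mem_window hx).mono fun _ => Or.inr
        · by_cases hx : d x = v
          · simp [hx]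
          · exact (eventually_not_mem_window_ereal hx).mono fun _ => Or.inr
    obtain ⟨ε, h0, h1, h2⟩ := key.exists
    refine (show properMultiplicity β u v ≤ _ from
      Nat.sInf_le ⟨ε, h0, h1, (h.box h0 h1).symm⟩).trans (card_le_card fun x => ?_)
    simp only [mem_filter, mem_univ, true_and]
    exact fun hx => ⟨(h2 x).1.resolve_right (not_not.2 hx.1),
      (h2 x).2.resolve_right (not_not.2 hx.2)⟩
  -- Some admissible `ε` is needed, because `sInf ∅ = 0` in `ℕ`.
  · have hne : 0 < (v - u) / 4 ∧ u + (v - u) / 4 < v - (v - u) / 4 := by constructor <;> linarith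
    unfold properMultiplicity
    refine le_csInf ?_ ?_
    · exact ⟨_, _, hne.1, hne.2, (h.box hne.1 hne.2).symm⟩
    rintro m ⟨ε, h0, h1, hm⟩
    rw [h.box h0 h1, Nat.cast_inj] at hm
    rw [hm]
    refine card_le_card fun x => ?_
    simp only [mem_filter, mem_univ, true_and]
    rintro ⟨rfl, hx⟩
    rw [hx]
    refine ⟨⟨by linarith, by linarith⟩, EReal.coe_lt_coe_iff.2 (by linarith),
      EReal.coe_le_coe_iff.2 (by linarith)⟩

open Classical in
theorem IsBarcode.infiniteMultiplicity_eq (h : IsBarcode β b d) (u : ℝ) :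
    infiniteMultiplicity β u = #{x | b x = u ∧ d x = ⊤} := by
  have hinv : Tendsto (fun ε : ℝ => 1 / ε) (𝓝[>] 0) atTop := by
    simpa using tendsto_inv_nhdsGT_zero (𝕜 := ℝ)
  -- For small `ε` the bound `1 / ε` is at or above every finite death, so only infinite bars
  -- survive it.
  have key : ∀ᶠ ε : ℝ in 𝓝[>] 0, 0 < ε ∧ u + ε < 1 / ε ∧
      ∀ x, (b x = u ∨ ¬ (u - ε < b x ∧ b x ≤ u + ε)) ∧
        (d x = ⊤ ∨ ¬ (((1 / ε : ℝ) : EReal) < d x)) := by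
    refine eventually_mem_nhdsWithin.and (Eventually.and ?_ (eventually_all.2 fun x => ?_))
    · have : ∀ᶠ ε : ℝ in 𝓝[>] 0, ε < 1 := nhdsWithin_le_nhds (Iio_mem_nhds one_pos)
      filter_upwards [this, hinv.eventually_gt_atTop (u + 1)] with ε h1 h2 using by linarith
    · refine Eventually.and ?_ ?_
      · by_cases hx : b x = u
        · simp [hx]
        · exact (eventually_not_mem_window hx).mono fun _ => Or.inr
      · cases hd : d x with
        | bot => simp
        | top => simp
        | coe a =>
          filter_upwards [hinv.eventually_ge_atTop a] with ε hε
          exact Or.inr (not_lt.2 (EReal.coe_le_coe_iff.2 hε))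
  obtain ⟨ε, h0, h1, h2⟩ := key.exists
  apply le_antisymm
  · refine (show infiniteMultiplicity β u ≤ _ from
      Nat.sInf_le ⟨ε, h0, h1, (h.strip h0 h1).symm⟩).trans (card_le_card fun x => ?_)
    simp only [mem_filter, mem_univ, true_and]
    exact fun hx => ⟨(h2 x).1.resolve_right (not_not.2 hx.1),
      (h2 x).2.resolve_right (not_not.2 hx.2)⟩
  · unfold infiniteMultiplicity
    refine le_csInf ?_ ?_
    · exact ⟨_, _, h0, h1, (h.strip h0 h1).symm⟩
    rintro m ⟨ε, h0, h1, hm⟩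
    rw [h.strip h0 h1, Nat.cast_inj] at hm
    rw [hm]
    refine card_le_card fun x => ?_
    simp only [mem_filter, mem_univ, true_and]
    rintro ⟨rfl, hx⟩
    rw [hx]
    exact ⟨⟨by linarith, by linarith⟩, EReal.coe_lt_top _⟩

open Classical in
theorem IsBarcode.multiplicity_eq (h : IsBarcode β b d) {p : ℝ × EReal}
    (hp : p.2 ≠ (p.1 : EReal)) :
    multiplicity β p = (#{x | (b x, d x) = p} : ℕ) := by
  obtain ⟨u, v⟩ := p
  simp only [multiplicity, Prod.mk.injEq]
  dsimp only at hp
  rw [if_neg hp]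
  split_ifs with h1 h2
  · subst h1
    rw [h.infiniteMultiplicity_eq]
  · lift v to ℝ using ⟨h1, (lt_of_le_of_lt bot_le h2).ne'⟩
    rw [EReal.toReal_coe, h.properMultiplicity_eq (EReal.coe_lt_coe_iff.1 h2)]
  · symm
    rw [Nat.cast_eq_zero, card_eq_zero, filter_eq_empty_iff]
    rintro x - ⟨rfl, rfl⟩
    exact h2 (lt_of_le_of_ne (h.1 x) (Ne.symm hp))

/-- The point of the half-plane given by a bar or by a numbered copy of a diagonal point. -/
def barPoint (b : ι → ℝ) (d : ι → EReal) : ι ⊕ ℝ × ℕ → ℝ × EReal :=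
  Sum.elim (fun x => (b x, d x)) fun y => (y.1, (y.1 : EReal))

open Classical in
-- Off the diagonal both fibers are finite of the same size. On it both are countably infinite,
-- which absorbs the empty bars.
theorem IsBarcode.nonempty_fiber_equiv (h : IsBarcode β b d) (p : ℝ × EReal) :
    Nonempty ({x : Diagram β // x.1.1 = p} ≃ {y // barPoint b d y = p}) := by
  have e1 : {x : Diagram β // x.1.1 = p} ≃ {k : ℕ // (k : ℕ∞) < multiplicity β p} :=
    { toFun := fun x => ⟨x.1.1.2, by have := x.1.2; rwa [x.2] at this⟩
      invFun := fun k => ⟨⟨(p, k.1), k.2⟩, rfl⟩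
      left_inv := by rintro ⟨⟨⟨p, k⟩, hk⟩, rfl⟩; rfl
      right_inv := fun _ => rfl }
  by_cases hp : p.2 = (p.1 : EReal)
  · have hm : multiplicity β p = ⊤ := by simp [multiplicity, hp]
    have e2 : {k : ℕ // (k : ℕ∞) < multiplicity β p} ≃ ℕ :=
      Equiv.subtypeUnivEquiv fun k => by rw [hm]; exact ENat.natCast_lt_top k
    have i1 : Function.Injective fun y : {y // barPoint b d y = p} =>
        Sum.map id Prod.snd y.1 := by
      rintro ⟨x | ⟨x, k⟩, hx⟩ ⟨y | ⟨y, l⟩, hy⟩ hxy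
      · simpa using hxy
      · simp at hxy
      · simp at hxy
      · simp only [barPoint, Sum.elim_inr] at hx hy
        have : x = y := congrArg Prod.fst (hx.trans hy.symm)
        subst this
        exact Subtype.ext (by simpa using hxy)
    have : Countable {y // barPoint b d y = p} := i1.countable
    have i2 : Function.Injective fun k : ℕ =>
        (⟨Sum.inr (p.1, k), by simp [barPoint, ← hp]⟩ : {y // barPoint b d y = p}) :=
      fun k l hkl => by simpa using hkl
    have : Infinite {y // barPoint b d y = p} := Infinite.of_injective _ i2
    obtain ⟨e3⟩ := nonempty_equiv_of_countable (α := ℕ) (β := {y // barPoint b d y = p})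
    exact ⟨e1.trans (e2.trans e3)⟩
  · rw [h.multiplicity_eq hp] at e1
    have e2 : {k : ℕ // (k : ℕ∞) < (#{x | (b x, d x) = p} : ℕ)} ≃ Fin #{x | (b x, d x) = p} :=
      ⟨fun k => ⟨k.1, by exact_mod_cast k.2⟩, fun k => ⟨k.1, by exact_mod_cast k.2⟩,
        fun _ => rfl, fun _ => rfl⟩
    have e3 : {x // (b x, d x) = p} ≃ {y // barPoint b d y = p} :=
      { toFun := fun x => ⟨Sum.inl x.1, x.2⟩
        invFun := fun y => match y with
          | ⟨Sum.inl x, hx⟩ => ⟨x, hx⟩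
          | ⟨Sum.inr x, hx⟩ => absurd (by rw [← hx]; rfl) hp
        left_inv := fun _ => rfl
        right_inv := by
          rintro ⟨x | x, hx⟩
          · rfl
          · exact absurd (by rw [← hx]; rfl) hp }
    exact ⟨e1.trans (e2.trans ((Fintype.equivFinOfCardEq (Fintype.card_subtype _)).symm.trans e3))⟩

theorem IsBarcode.exists_equiv (h : IsBarcode β b d) :
    ∃ e : Diagram β ≃ ι ⊕ ℝ × ℕ, ∀ x, barPoint b d (e x) = x.1.1 := by
  have e := fun p => (h.nonempty_fiber_equiv p).some
  refine ⟨(Equiv.sigmaFiberEquiv fun x : Diagram β => x.1.1).symm.trans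
    ((Equiv.sigmaCongrRight e).trans (Equiv.sigmaFiberEquiv (barPoint b d))), fun x => ?_⟩
  exact (e x.1.1 ⟨x, rfl⟩).2

end Barcode

/-! ### Matchings of persistence diagrams -/

section Matching

/-- The points `p` and `q` are at bottleneck distance at most `c`: either their coordinates differ
by at most `c`, or both are within `c` of the diagonal. -/
def Close (c : ℝ) (p q : ℝ × EReal) : Prop :=
  (|p.1 - q.1| ≤ c ∧ p.2 ≤ q.2 + (c : EReal) ∧ q.2 ≤ p.2 + (c : EReal)) ∨
    (p.2 ≤ ((p.1 + 2 * c : ℝ) : EReal) ∧ q.2 ≤ ((q.1 + 2 * c : ℝ) : EReal))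

theorem le_coe_of_le_add {x y : EReal} {c s t : ℝ} (h : x ≤ y + (c : EReal))
    (hy : y ≤ (s : EReal)) (hst : s + c ≤ t) : x ≤ (t : EReal) :=
  h.trans ((add_le_add_left hy _).trans (by
    rw [← EReal.coe_add]; exact EReal.coe_le_coe_iff.2 hst))

theorem le_add_coe_trans {x y z : EReal} {a b : ℝ} (h : x ≤ y + (a : EReal))
    (h' : y ≤ z + (b : EReal)) : x ≤ z + ((a + b : ℝ) : EReal) :=
  h.trans ((add_le_add_left h' _).trans (by
    rw [add_assoc, ← EReal.coe_add, add_comm b a]))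

/-- In the mixed cases, moving each coordinate by at most `a` lengthens a bar by at most `2 * a`,
which matches the factor `2` in `Close`. -/
theorem Close.trans {a b : ℝ} (ha : 0 ≤ a) (hb : 0 ≤ b) {p q s : ℝ × EReal} (h : Close a p q)
    (h' : Close b q s) : Close (a + b) p s := by
  rcases h with ⟨h1, h2, h3⟩ | ⟨h1, h2⟩ <;> rcases h' with ⟨k1, k2, k3⟩ | ⟨k1, k2⟩
  · exact Or.inl ⟨(abs_sub_le _ _ _).trans (add_le_add h1 k1), le_add_coe_trans h2 k2,
      by rw [add_comm a b]; exact le_add_coe_trans k3 h3⟩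
  · refine Or.inr ⟨le_coe_of_le_add h2 k1 ?_, k2.trans (EReal.coe_le_coe_iff.2 (by linarith))⟩
    linarith [(abs_le.1 h1).1]
  · refine Or.inr ⟨h1.trans (EReal.coe_le_coe_iff.2 (by linarith)), le_coe_of_le_add k3 h2 ?_⟩
    linarith [(abs_le.1 k1).2]
  · exact Or.inr ⟨h1.trans (EReal.coe_le_coe_iff.2 (by linarith)),
      k2.trans (EReal.coe_le_coe_iff.2 (by linarith))⟩

theorem extDist_le_ofReal {x y : EReal} {c : ℝ} (h : x ≤ y + (c : EReal))
    (h' : y ≤ x + (c : EReal)) : extDist x y ≤ ENNReal.ofReal c := by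
  unfold extDist
  split_ifs with hxy
  · exact zero_le
  induction x with
  | bot => simp at h'; exact absurd h'.symm hxy
  | top => induction y with
    | bot => simp at h
    | top => exact absurd rfl hxy
    | coe y => rw [← EReal.coe_add] at h; exact absurd h (not_le.2 (EReal.coe_lt_top _))
  | coe x => induction y with
    | bot => simp at h
    | top => rw [← EReal.coe_add] at h'; exact absurd h' (not_le.2 (EReal.coe_lt_top _))
    | coe y =>
      rw [← EReal.coe_add, EReal.coe_le_coe_iff] at h h'
      rw [← EReal.coe_sub, EReal.abs_def]
      exact ENNReal.ofReal_le_ofReal (abs_le.2 ⟨by linarith, by linarith⟩)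

theorem toENNReal_sub_div_two_le {y : EReal} {x c : ℝ} (h : y ≤ ((x + 2 * c : ℝ) : EReal)) :
    (y - (x : EReal)).toENNReal / 2 ≤ ENNReal.ofReal c := by
  have h1 : y - (x : EReal) ≤ ((2 * c : ℝ) : EReal) := by
    rw [EReal.sub_le_iff_le_add (by simp) (by simp), ← EReal.coe_add, add_comm]
    exact h
  have h2 := EReal.toENNReal_le_toENNReal h1
  rw [EReal.toENNReal_of_ne_top (EReal.coe_ne_top _), EReal.toReal_coe,
    ENNReal.ofReal_mul zero_le_two] at h2
  refine (ENNReal.div_le_div_right h2 2).trans ?_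
  rw [ENNReal.ofReal_ofNat, mul_comm, ENNReal.mul_div_cancel_right two_ne_zero (by simp)]

theorem Close.pointDist_le {c : ℝ} {p q : ℝ × EReal} (h : Close c p q) :
    pointDist p q ≤ ENNReal.ofReal c := by
  rcases h with ⟨h1, h2, h3⟩ | ⟨h1, h2⟩
  · refine (min_le_left _ _).trans (max_le (extDist_le_ofReal ?_ ?_) (extDist_le_ofReal h2 h3)) <;>
      rw [← EReal.coe_add, EReal.coe_le_coe_iff] <;> linarith [abs_le.1 h1]
  · exact (min_le_right _ _).trans
      (max_le (toENNReal_sub_div_two_le h1) (toENNReal_sub_div_two_le h2))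

/-- The diagrams of `β` and `β'` admit a bijection which moves points by at most `c`. -/
def Matched (c : ℝ) (β β' : ℝ → ℝ → ℕ) : Prop :=
  ∃ σ : Diagram β ≃ Diagram β', ∀ P, Close c P.1.1 (σ P).1.1

theorem Matched.trans {a b : ℝ} (ha : 0 ≤ a) (hb : 0 ≤ b) {β₁ β₂ β₃ : ℝ → ℝ → ℕ}
    (h : Matched a β₁ β₂) (h' : Matched b β₂ β₃) : Matched (a + b) β₁ β₃ := by
  obtain ⟨σ, hσ⟩ := h
  obtain ⟨τ, hτ⟩ := h'
  exact ⟨σ.trans τ, fun P => (hσ P).trans ha hb (hτ (σ P))⟩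

theorem Matched.bottleneckDist_le {c : ℝ} {β β' : ℝ → ℝ → ℕ} (h : Matched c β β') :
    bottleneckDist β β' ≤ ENNReal.ofReal c := by
  obtain ⟨σ, hσ⟩ := h
  exact iInf_le_of_le σ (iSup_le fun P => (hσ P).pointDist_le)

/-- Bars are matched by index and each numbered diagonal copy with itself. -/
theorem IsBarcode.matched {ι : Type*} [Fintype ι] {β β' : ℝ → ℝ → ℕ} {b b' : ι → ℝ}
    {d d' : ι → EReal} (h : IsBarcode β b d) (h' : IsBarcode β' b' d') {c : ℝ} (hc : 0 ≤ c)
    (hclose : ∀ x, Close c (b x, d x) (b' x, d' x)) : Matched c β β' := by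
  obtain ⟨e, he⟩ := h.exists_equiv
  obtain ⟨e', he'⟩ := h'.exists_equiv
  refine ⟨e.trans e'.symm, fun P => ?_⟩
  rw [← he, ← he', Equiv.trans_apply, Equiv.apply_symm_apply]
  rcases e P with x | x
  · exact hclose x
  · exact Or.inr ⟨EReal.coe_le_coe_iff.2 (by simpa [barPoint] using hc),
      EReal.coe_le_coe_iff.2 (by simpa [barPoint] using hc)⟩

end Matching

/-! ### Filtrations of a fixed complex by real-valued functions -/

section RealFiltration

variable {F : Type*} [Field F] {V : Type*}

/-- `g` never decreases from a face to a larger simplex. -/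
def MonoOn (L : PreAbstractSimplicialComplex V) (g : Finset V → ℝ) : Prop :=
  ∀ σ ∈ L, ∀ τ ∈ L, τ ⊆ σ → g τ ≤ g σ

/-- The filtration of `L` by a real-valued function. -/
def realFiltered (L : PreAbstractSimplicialComplex V) (g : Finset V → ℝ) (hg : MonoOn L g) :
    FilteredComplex V where
  complex := L
  value σ := g σ
  mono σ hσ τ hτ h := EReal.coe_le_coe_iff.2 (hg σ hσ τ hτ h)

theorem mem_sublevel_realFiltered {L : PreAbstractSimplicialComplex V} {g : Finset V → ℝ}
    {hg : MonoOn L g} {u : ℝ} {σ : Finset V} :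
    σ ∈ (realFiltered L g hg).sublevel u ↔ σ ∈ L ∧ g σ ≤ u :=
  and_congr_right fun _ => EReal.coe_le_coe_iff

theorem cycles_le_chains (K : PreAbstractSimplicialComplex V) (n : ℕ) :
    cycles F K n ≤ chains F K n := by
  cases n with
  | zero => exact le_rfl
  | succ n => exact inf_le_left

theorem cycles_eq_bot {K : PreAbstractSimplicialComplex V} (h : ∀ σ, σ ∉ K) (n : ℕ) :
    cycles F K n = ⊥ := by
  refine le_bot_iff.1 ((cycles_le_chains K n).trans (le_of_eq ?_))
  have : {x : Fin (n + 1) → V | ∃ σ ∈ K, ∀ i, x i ∈ σ} = ∅ := by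
    ext x; simp [h]
  rw [chains, this]
  exact Finsupp.supported_empty

theorem pbn_eq [Finite V] (X : FilteredComplex V) (r : ℕ) {u v : ℝ} (h : u < v) :
    (pbn F X r u v : ℤ) = finrank F (cycles F (X.sublevel u) r)
      - finrank F ↥(cycles F (X.sublevel u) r ⊓ boundaries F (X.sublevel v) r) := by
  rw [pbn, dif_pos h, eq_sub_iff_add_eq]
  exact_mod_cast finrank_range_homologyMap (X.sublevel_mono h.le) r

open Finset

variable [Fintype V]

open Classical in
/-- The smallest value of `g` on the simplices of rank at least `i` (`⊤` if there are none). -/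
def levelValue (L : PreAbstractSimplicialComplex V) (ρ : Finset V → ℕ) (g : Finset V → ℝ)
    (i : ℕ) : EReal :=
  ({σ | σ ∈ L ∧ i ≤ ρ σ} : Finset (Finset V)).inf fun σ => (g σ : EReal)

variable {L : PreAbstractSimplicialComplex V} {ρ : Finset V → ℕ} {g g' : Finset V → ℝ}

theorem levelValue_le_coe_iff {i : ℕ} {u : ℝ} :
    levelValue L ρ g i ≤ u ↔ ∃ σ ∈ L, i ≤ ρ σ ∧ g σ ≤ u := by
  rw [levelValue, Finset.inf_le_iff (EReal.coe_lt_top u)]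
  simp [and_assoc]

theorem levelValue_ne_bot (i : ℕ) : levelValue L ρ g i ≠ ⊥ := by
  refine (bot_lt_iff_ne_bot.1 ((Finset.lt_inf_iff bot_lt_top).2 fun σ _ => EReal.bot_lt_coe _))

theorem levelValue_mono {i j : ℕ} (h : i ≤ j) : levelValue L ρ g i ≤ levelValue L ρ g j := by
  classical
  refine Finset.inf_mono fun σ => ?_
  simp only [mem_filter, mem_univ, true_and]
  exact fun hσ => ⟨hσ.1, h.trans hσ.2⟩

theorem levelValue_le_add {c : ℝ} (h : ∀ σ ∈ L, g' σ ≤ g σ + c) (i : ℕ) :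
    levelValue L ρ g' i ≤ levelValue L ρ g i + (c : EReal) := by
  classical
  rw [← EReal.sub_le_iff_le_add (by simp) (by simp)]
  refine Finset.le_inf fun σ hσ => ?_
  rw [EReal.sub_le_iff_le_add (by simp) (by simp)]
  refine (Finset.inf_le hσ).trans ?_
  simp only [mem_filter, mem_univ, true_and] at hσ
  rw [← EReal.coe_add]
  exact EReal.coe_le_coe_iff.2 (h σ hσ.1)

/-- The bars `[p, q)` depend on `ρ` alone. A sublevel complex of `g` consists of the simplices up to
some rank, so `g` only decides at which real value each rank is reached. -/
theorem exists_isBarcode (F : Type*) [Field F] (hρ : MonoOn L fun σ => (ρ σ : ℝ))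
    (hpos : ∀ σ ∈ L, 1 ≤ ρ σ) (r : ℕ) :
    ∃ (ι : Type) (_ : Fintype ι) (p q : ι → ℕ),
      (∀ x, ∃ σ ∈ L, p x ≤ ρ σ) ∧
      ∀ (g : Finset V → ℝ) (hg : MonoOn L g), (∀ σ ∈ L, ∀ τ ∈ L, ρ σ ≤ ρ τ → g σ ≤ g τ) →
        IsBarcode (pbn F (realFiltered L g hg) r)
          (fun x => (levelValue L ρ g (p x)).toReal) fun x => levelValue L ρ g (q x) := by
  classical
  set K : ℕ → PreAbstractSimplicialComplex V :=
    fun i => (realFiltered L (fun σ => (ρ σ : ℝ)) hρ).sublevel i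
  have memK : ∀ i σ, σ ∈ K i ↔ σ ∈ L ∧ ρ σ ≤ i := fun i σ => by
    simp [K, mem_sublevel_realFiltered]
  have monoK : Monotone K := fun i j h =>
    (realFiltered L (fun σ => (ρ σ : ℝ)) hρ).sublevel_mono (by exact_mod_cast h)
  set N : ℕ := ({σ | σ ∈ L} : Finset (Finset V)).sup ρ
  -- Past the top rank `N` every cycle is declared a boundary. Surviving classes then die at `N +
  -- 1`, where `levelValue` is an infimum over no simplices, hence `⊤`.
  set B : ℕ → Submodule F (TupleSpace F V (r + 1)) :=
    fun j => if j ≤ N then boundaries F (K j) r else ⊤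
  have hBle : ∀ j ≤ N, B j = boundaries F (K j) r := fun j hj => if_pos hj
  have hBtop : B (N + 1) = ⊤ := if_neg (by omega)
  have monoB : Monotone B := fun i j h => by
    by_cases hj : j ≤ N
    · simpa only [B, if_pos hj, if_pos (h.trans hj)] using boundaries_mono F (monoK h) r
    · simp only [B, if_neg hj, le_top]
  obtain ⟨ι, hι, p, q, hpq, hcard⟩ := exists_bars
    (fun i j => (finrank F (cycles F (K i) r) : ℤ) - finrank F ↥(cycles F (K i) r ⊓ B j)) N
    (fun j => by
      have : cycles F (K 0) r = ⊥ := cycles_eq_bot (fun σ hσ => by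
        have h := (memK 0 σ).1 hσ
        have := hpos σ h.1
        omega) r
      rw [this]; simp)
    (fun i => by rw [hBtop, inf_top_eq, sub_self])
    (fun i j => by
      have := finrank_inf_add_finrank_inf_le (cycles_mono F (monoK i.le_succ) r) (monoB j.le_succ)
      simp only [Nat.succ_eq_add_one] at this
      linarith)
  have hp : ∀ x, ∃ σ ∈ L, p x ≤ ρ σ := fun x => by
    have := (Finset.le_sup_iff (Nat.lt_of_lt_of_le Nat.zero_lt_one (hpq x).1)).1 (hpq x).2.1
    simpa using this
  refine ⟨ι, hι, p, q, hp, fun g hg hρg => ?_⟩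
  have hb : ∀ x, ((levelValue L ρ g (p x)).toReal : EReal) = levelValue L ρ g (p x) := fun x => by
    refine EReal.coe_toReal ?_ (levelValue_ne_bot _)
    obtain ⟨σ, hσ, h⟩ := hp x
    exact (lt_of_le_of_lt (levelValue_le_coe_iff.2 ⟨σ, hσ, h, le_rfl⟩) (EReal.coe_lt_top _)).ne
  set n : ℝ → ℕ := fun u => ({σ | σ ∈ L ∧ g σ ≤ u} : Finset (Finset V)).sup ρ
  -- A Galois connection between ranks and values; `1 ≤ i` is needed because the supremum of no
  -- ranks is `0`.
  have hn : ∀ (i : ℕ) (u : ℝ), 1 ≤ i → (levelValue L ρ g i ≤ u ↔ i ≤ n u) := fun i u hi => by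
    rw [levelValue_le_coe_iff, Finset.le_sup_iff (Nat.lt_of_lt_of_le Nat.zero_lt_one hi)]
    simp [and_assoc, and_comm]
  have hsub : ∀ u, (realFiltered L g hg).sublevel u = K (n u) := fun u => by
    refine SetLike.ext fun σ => ?_
    rw [mem_sublevel_realFiltered, memK]
    refine and_congr_right fun hσ => ?_
    rw [← hn _ _ (hpos σ hσ), levelValue_le_coe_iff]
    exact ⟨fun h => ⟨σ, hσ, le_rfl, h⟩,
      fun ⟨τ, hτ, h, h'⟩ => (hρg σ hσ τ hτ h).trans h'⟩
  have hnN : ∀ u, n u ≤ N := fun u => Finset.sup_mono fun σ => by simp +contextual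
  refine ⟨fun x => ?_, fun u v huv => ?_⟩
  · rw [hb]
    exact levelValue_mono (hpq x).2.2.le
  · have hnuv : n u ≤ n v := Finset.sup_mono fun σ => by
      simp only [mem_filter, mem_univ, true_and]
      exact fun h => ⟨h.1, h.2.trans huv.le⟩
    have h1 := hcard (n u) (n v) hnuv (hnN v)
    have h2 := pbn_eq (F := F) (realFiltered L g hg) r huv
    rw [hsub, hsub] at h2
    rw [hBle _ (hnN v), ← h2, Nat.cast_inj] at h1
    rw [h1]
    congr 1
    ext x
    simp only [mem_filter, mem_univ, true_and]
    rw [← EReal.coe_le_coe_iff, hb, hn _ _ (hpq x).1, ← not_le (a := levelValue L ρ g (q x)),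
      hn _ _ ((hpq x).1.trans (hpq x).2.2.le), not_le]

theorem matched_of_rank (hρ : MonoOn L fun σ => (ρ σ : ℝ)) (hpos : ∀ σ ∈ L, 1 ≤ ρ σ)
    (hg : MonoOn L g) (hg' : MonoOn L g')
    (h : ∀ σ ∈ L, ∀ τ ∈ L, ρ σ ≤ ρ τ → g σ ≤ g τ)
    (h' : ∀ σ ∈ L, ∀ τ ∈ L, ρ σ ≤ ρ τ → g' σ ≤ g' τ) {c : ℝ} (hc : 0 ≤ c)
    (hd : ∀ σ ∈ L, |g σ - g' σ| ≤ c) (r : ℕ) :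
    Matched c (pbn F (realFiltered L g hg) r) (pbn F (realFiltered L g' hg') r) := by
  obtain ⟨ι, hι, p, q, hp, hbar⟩ := exists_isBarcode F hρ hpos r
  refine (hbar g hg h).matched (hbar g' hg' h') hc fun x => Or.inl ?_
  have h1 := levelValue_le_add (ρ := ρ) (L := L) (g := g) (g' := g') (c := c)
    fun σ hσ => by linarith [abs_le.1 (hd σ hσ)]
  have h2 := levelValue_le_add (ρ := ρ) (L := L) (g := g') (g' := g) (c := c)
    fun σ hσ => by linarith [abs_le.1 (hd σ hσ)]
  refine ⟨?_, h2 _, h1 _⟩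
  have hb : ∀ g, ((levelValue L ρ g (p x)).toReal : EReal) = levelValue L ρ g (p x) := fun g => by
    refine EReal.coe_toReal ?_ (levelValue_ne_bot _)
    obtain ⟨σ, hσ, h⟩ := hp x
    exact (lt_of_le_of_lt (levelValue_le_coe_iff.2 ⟨σ, hσ, h, le_rfl⟩) (EReal.coe_lt_top _)).ne
  have h1 := h1 (p x)
  have h2 := h2 (p x)
  rw [← hb g, ← hb g', ← EReal.coe_add, EReal.coe_le_coe_iff] at h1 h2
  exact abs_le.2 ⟨by linarith, by linarith⟩

/-- Ordering simplices by `g + g'` orders them weakly by both functions. The rank of a simplex is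
the number of simplices whose sum does not exceed its own; it counts itself, so it is positive. -/
theorem matched_of_concordant (hg : MonoOn L g) (hg' : MonoOn L g')
    (h : ∀ σ ∈ L, ∀ τ ∈ L, g σ < g τ → g' σ ≤ g' τ) {c : ℝ} (hc : 0 ≤ c)
    (hd : ∀ σ ∈ L, |g σ - g' σ| ≤ c) (r : ℕ) :
    Matched c (pbn F (realFiltered L g hg) r) (pbn F (realFiltered L g' hg') r) := by
  classical
  set ρ : Finset V → ℕ := fun σ =>
    #{τ : Finset V | τ ∈ L ∧ g τ + g' τ ≤ g σ + g' σ}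
  have key : ∀ σ ∈ L, ∀ τ ∈ L, ρ σ ≤ ρ τ → g σ + g' σ ≤ g τ + g' τ := fun σ hσ τ hτ => by
    contrapose!
    refine fun hlt => card_lt_card (Finset.ssubset_iff_of_subset ?_ |>.2 ⟨σ, ?_, ?_⟩)
    · intro x
      simp only [mem_filter, mem_univ, true_and]
      exact fun hx => ⟨hx.1, hx.2.trans hlt.le⟩
    · simpa using hσ
    · simpa using fun _ => hlt
  refine matched_of_rank (ρ := ρ) (fun σ hσ τ hτ hτσ => ?_) (fun σ hσ => ?_) hg hg'
    (fun σ hσ τ hτ hr => ?_) (fun σ hσ τ hτ hr => ?_) hc hd r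
  · refine Nat.cast_le.2 (card_le_card fun x => ?_)
    simp only [mem_filter, mem_univ, true_and]
    exact fun hx => ⟨hx.1, hx.2.trans (add_le_add (hg σ hσ τ hτ hτσ) (hg' σ hσ τ hτ hτσ))⟩
  · exact card_pos.2 ⟨σ, by simpa using hσ⟩
  · have := key σ hσ τ hτ hr
    by_contra! hlt
    linarith [h τ hτ σ hσ hlt]
  · have := key σ hσ τ hτ hr
    by_contra! hlt
    have : g σ < g τ := by linarith
    linarith [h σ hσ τ hτ this]

omit [Fintype V] in
theorem MonoOn.interpolate (hg : MonoOn L g) (hg' : MonoOn L g') {s : ℝ} (h0 : 0 ≤ s)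
    (h1 : s ≤ 1) : MonoOn L fun σ => (1 - s) * g σ + s * g' σ := fun σ hσ τ hτ h =>
  add_le_add (mul_le_mul_of_nonneg_left (hg σ hσ τ hτ h) (by linarith))
    (mul_le_mul_of_nonneg_left (hg' σ hσ τ hτ h) h0)

open Classical in
/-- The pairs of simplices which `g` and `g'` put in opposite orders. -/
def inversions (L : PreAbstractSimplicialComplex V) (g g' : Finset V → ℝ) :
    Finset (Finset V × Finset V) :=
  {x | (x.1 ∈ L ∧ x.2 ∈ L) ∧ g x.1 < g x.2 ∧ g' x.2 < g' x.1}

theorem mem_inversions {x : Finset V × Finset V} :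
    x ∈ inversions L g g' ↔ (x.1 ∈ L ∧ x.2 ∈ L) ∧ g x.1 < g x.2 ∧ g' x.2 < g' x.1 := by
  simp [inversions]

/-- Stability of persistence diagrams, for two real-valued filtrations of a finite complex. -/
theorem matched_realFiltered (hg : MonoOn L g) (hg' : MonoOn L g') {c : ℝ} (hc : 0 ≤ c)
    (hd : ∀ σ ∈ L, |g σ - g' σ| ≤ c) (r : ℕ) :
    Matched c (pbn F (realFiltered L g hg) r) (pbn F (realFiltered L g' hg') r) := by
  induction hm : #(inversions L g g') using Nat.strong_induction_on generalizing g c with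
  | _ m ih =>
  by_cases hne : (inversions L g g').Nonempty
  swap
  · refine matched_of_concordant hg hg' (fun σ hσ τ hτ hlt => ?_) hc hd r
    by_contra! hlt'
    exact hne ⟨(σ, τ), mem_inversions.2 ⟨⟨hσ, hτ⟩, hlt, hlt'⟩⟩
  -- The quotient is the time `s` at which `(1 - s) * g + s * g'` ties the pair; `x` is an inversion
  -- tied first.
  obtain ⟨x, hx, hmin⟩ := Finset.exists_min_image _ (fun x : Finset V × Finset V =>
    (g x.2 - g x.1) / ((g x.2 - g x.1) + (g' x.1 - g' x.2))) hne
  have hx' := mem_inversions.1 hx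
  set s : ℝ := (g x.2 - g x.1) / ((g x.2 - g x.1) + (g' x.1 - g' x.2)) with hs
  have hA : 0 < g x.2 - g x.1 := sub_pos.2 hx'.2.1
  have hB : 0 < g' x.1 - g' x.2 := sub_pos.2 hx'.2.2
  have hs0 : 0 < s := div_pos hA (add_pos hA hB)
  have hs1 : s < 1 := (div_lt_one (add_pos hA hB)).2 (by linarith)
  have hsx : s * ((g x.2 - g x.1) + (g' x.1 - g' x.2)) = g x.2 - g x.1 :=
    div_mul_cancel₀ _ (add_pos hA hB).ne'
  have hgs := hg.interpolate hg' hs0.le hs1.le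
  have h1 : Matched (s * c) (pbn F (realFiltered L g hg) r) (pbn F (realFiltered L _ hgs) r) := by
    refine matched_of_concordant hg hgs (fun σ hσ τ hτ hlt => ?_) (by positivity)
      (fun σ hσ => ?_) r
    · by_contra! hlt'
      have hinv : g' τ < g' σ := by
        by_contra! hle
        have := mul_le_mul_of_nonneg_left hlt.le (sub_nonneg.2 hs1.le)
        have := mul_le_mul_of_nonneg_left hle hs0.le
        linarith
      -- A pair already reversed at time `s` would have been tied strictly earlier than `x`.
      have := hmin (σ, τ) (mem_inversions.2 ⟨⟨hσ, hτ⟩, hlt, hinv⟩)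
      rw [le_div_iff₀ (by dsimp only; linarith)] at this
      dsimp only at this
      nlinarith
    · rw [show g σ - ((1 - s) * g σ + s * g' σ) = s * (g σ - g' σ) by ring, abs_mul,
        abs_of_pos hs0]
      exact mul_le_mul_of_nonneg_left (hd σ hσ) hs0.le
  have h2 : Matched ((1 - s) * c) (pbn F (realFiltered L _ hgs) r)
      (pbn F (realFiltered L g' hg') r) := by
    refine ih _ ?_ hgs (mul_nonneg (by linarith) hc) (fun σ hσ => ?_) rfl
    · rw [← hm]
      -- Interpolating towards `g'` creates no inversion with `g'`, and `x`, now tied, is no longer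
      -- one.
      refine card_lt_card (Finset.ssubset_iff_of_subset ?_ |>.2 ⟨x, hx, ?_⟩)
      · intro y
        rw [mem_inversions, mem_inversions]
        rintro ⟨hy, hlt, hlt'⟩
        refine ⟨hy, ?_, hlt'⟩
        by_contra! hle
        have := mul_le_mul_of_nonneg_left hle (sub_nonneg.2 hs1.le)
        have := mul_le_mul_of_nonneg_left hlt'.le hs0.le
        linarith
      · rw [mem_inversions]
        rintro ⟨-, hlt, -⟩
        linarith
    · rw [show (1 - s) * g σ + s * g' σ - g' σ = (1 - s) * (g σ - g' σ) by ring, abs_mul,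
        abs_of_pos (sub_pos.2 hs1)]
      exact mul_le_mul_of_nonneg_left (hd σ hσ) (by linarith)
  have h3 := h1.trans (mul_nonneg hs0.le hc) (mul_nonneg (by linarith) hc) h2
  rwa [← add_mul, add_sub_cancel, one_mul] at h3

end RealFiltration

/-! ### Invariance under bijections of the vertices -/

section Transport

variable {F : Type*} [Field F] {V V' : Type*}

/-- The map on tuples induced by a bijection of the vertices. -/
def tupleMap (F : Type*) [Field F] (e : V ≃ V') (n : ℕ) :
    TupleSpace F V n →ₗ[F] TupleSpace F V' n :=
  Finsupp.lmapDomain F F fun x : Fin n → V => e ∘ x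

theorem tupleMap_injective (e : V ≃ V') (n : ℕ) : Function.Injective (tupleMap F e n) :=
  Finsupp.mapDomain_injective fun _ _ h => funext fun i => e.injective (congrFun h i)

theorem boundary_tupleMap (e : V ≃ V') (n : ℕ) (x : TupleSpace F V (n + 1)) :
    boundary F V' n (tupleMap F e (n + 1) x) = tupleMap F e n (boundary F V n x) := by
  have : boundary F V' n ∘ₗ tupleMap F e (n + 1) = tupleMap F e n ∘ₗ boundary F V n := by
    refine Finsupp.lhom_ext' fun x => LinearMap.ext_ring ?_
    change Finsupp.linearCombination F _ (Finsupp.mapDomain _ (Finsupp.single x 1))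
      = Finsupp.mapDomain _ (Finsupp.linearCombination F _ (Finsupp.single x 1))
    rw [Finsupp.mapDomain_single, Finsupp.linearCombination_single,
      Finsupp.linearCombination_single, one_smul, one_smul]
    erw [Finsupp.mapDomain_finsetSum]
    simp only [Finsupp.mapDomain_single]
    rfl
  exact LinearMap.congr_fun this x

variable {e : V ≃ V'} {K L : PreAbstractSimplicialComplex V}
  {K' L' : PreAbstractSimplicialComplex V'}

theorem map_chains (h : ∀ σ, σ ∈ K ↔ σ.map e.toEmbedding ∈ K') (n : ℕ) :
    (chains F K n).map (tupleMap F e (n + 1)) = chains F K' n := by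
  refine (Finsupp.lmapDomain_supported F F _ _).trans ?_
  rw [chains]
  congr 1
  ext y
  constructor
  · rintro ⟨x, ⟨σ, hσ, hx⟩, rfl⟩
    exact ⟨_, (h σ).1 hσ, fun i => Finset.mem_map_of_mem _ (hx i)⟩
  · rintro ⟨σ, hσ, hy⟩
    refine ⟨e.symm ∘ y, ⟨σ.map e.symm.toEmbedding, (h _).2 ?_, fun i =>
      Finset.mem_map_of_mem _ (hy i)⟩, by ext; simp⟩
    rwa [Finset.map_map, ← Equiv.trans_toEmbedding, Equiv.symm_trans_self,
      Equiv.refl_toEmbedding, Finset.map_refl]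

theorem map_cycles (h : ∀ σ, σ ∈ K ↔ σ.map e.toEmbedding ∈ K') (n : ℕ) :
    (cycles F K n).map (tupleMap F e (n + 1)) = cycles F K' n := by
  cases n with
  | zero => exact map_chains h 0
  | succ n =>
    rw [cycles, cycles, ← map_chains h]
    ext y
    constructor
    · rintro ⟨x, ⟨hx, hx'⟩, rfl⟩
      refine ⟨⟨x, hx, rfl⟩, ?_⟩
      rw [SetLike.mem_coe, LinearMap.mem_ker] at hx' ⊢
      rw [boundary_tupleMap, hx', map_zero]
    · rintro ⟨⟨x, hx, rfl⟩, hx'⟩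
      refine ⟨x, ⟨hx, ?_⟩, rfl⟩
      rw [SetLike.mem_coe, LinearMap.mem_ker] at hx' ⊢
      rw [boundary_tupleMap] at hx'
      exact tupleMap_injective e _ (hx'.trans (map_zero _).symm)

theorem map_boundaries (h : ∀ σ, σ ∈ K ↔ σ.map e.toEmbedding ∈ K') (n : ℕ) :
    (boundaries F K n).map (tupleMap F e (n + 1)) = boundaries F K' n := by
  rw [boundaries, boundaries, ← map_chains h, ← Submodule.map_comp, ← Submodule.map_comp]
  congr 1
  exact LinearMap.ext fun x => (boundary_tupleMap e _ x).symm

theorem finrank_map_tupleMap {n : ℕ} (S : Submodule F (TupleSpace F V n)) :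
    finrank F (S.map (tupleMap F e n)) = finrank F S :=
  (Submodule.equivMapOfInjective _ (tupleMap_injective e n) S).finrank_eq.symm

/-- By `pbn_eq` only dimensions of cycles, boundaries and their intersections matter, and the
injective `tupleMap` preserves them. -/
theorem pbn_eq_of_equiv [Finite V] [Finite V'] (X : FilteredComplex V) (Y : FilteredComplex V')
    (e : V ≃ V') (h : ∀ u σ, σ ∈ X.sublevel u ↔ σ.map e.toEmbedding ∈ Y.sublevel u) (r : ℕ) :
    pbn F X r = pbn F Y r := by
  ext u v
  by_cases huv : u < v
  · have h1 := pbn_eq (F := F) X r huv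
    have h2 := pbn_eq (F := F) Y r huv
    rw [← map_cycles (h u), ← map_boundaries (h v), ← Submodule.map_inf _ (tupleMap_injective e _),
      finrank_map_tupleMap, finrank_map_tupleMap, ← h1] at h2
    exact_mod_cast h2.symm
  · simp only [pbn, dif_neg huv]

theorem map_map_symm (e : V ≃ V') (σ : Finset V) :
    (σ.map e.toEmbedding).map e.symm.toEmbedding = σ := by
  rw [Finset.map_map, ← Equiv.trans_toEmbedding, Equiv.self_trans_symm, Equiv.refl_toEmbedding,
    Finset.map_refl]

/-- The subcomplex of the simplices with finite value. -/
def FilteredComplex.finitePart (X : FilteredComplex V) : PreAbstractSimplicialComplex V where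
  faces := {σ | σ ∈ X.complex ∧ X.value σ ≠ ⊤}
  isRelLowerSet_faces := by
    rintro σ ⟨hσ, hu⟩
    refine ⟨(X.complex.isRelLowerSet_faces hσ).1, fun τ hτσ hτ => ?_⟩
    have h := (X.complex.isRelLowerSet_faces hσ).2 hτσ hτ
    exact ⟨h, ne_top_of_le_ne_top hu (X.mono σ hσ τ h hτσ)⟩

theorem FilteredComplex.value_ne_bot (X : FilteredComplex V) (h : ∀ v, X.value {v} ≠ ⊥)
    {σ : Finset V} (hσ : σ ∈ X.complex) : X.value σ ≠ ⊥ := by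
  obtain ⟨hne, hface⟩ := X.complex.isRelLowerSet_faces hσ
  obtain ⟨v, hv⟩ := hne
  have hvσ : ({v} : Finset V) ⊆ σ := Finset.singleton_subset_iff.2 hv
  exact ne_bot_of_le_ne_bot (h v)
    (X.mono σ hσ {v} (hface hvσ (Finset.singleton_nonempty v)) hvσ)

/-- Stability of persistence diagrams, for filtered complexes identified by a bijection of their
vertices. -/
theorem matched_of_equiv [Finite V] [Finite V'] (X : FilteredComplex V) (Y : FilteredComplex V')
    (e : V ≃ V') (hmem : ∀ σ ∈ X.complex, σ.map e.toEmbedding ∈ Y.complex)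
    (hmem' : ∀ σ ∈ Y.complex, σ.map e.symm.toEmbedding ∈ X.complex)
    (hX : ∀ v, X.value {v} ≠ ⊥) (hY : ∀ v, Y.value {v} ≠ ⊥) {c : ℝ} (hc : 0 ≤ c)
    (hXY : ∀ σ ∈ X.complex, Y.value (σ.map e.toEmbedding) ≤ X.value σ + (c : EReal))
    (hYX : ∀ σ ∈ Y.complex, X.value (σ.map e.symm.toEmbedding) ≤ Y.value σ + (c : EReal)) (r : ℕ) :
    Matched c (pbn F X r) (pbn F Y r) := by
  have := Fintype.ofFinite V
  have hYX' : ∀ σ ∈ X.complex, X.value σ ≤ Y.value (σ.map e.toEmbedding) + (c : EReal) :=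
    fun σ hσ => by have := hYX _ (hmem σ hσ); rwa [map_map_symm] at this
  have hiff : ∀ σ, σ ∈ X.complex ↔ σ.map e.toEmbedding ∈ Y.complex := fun σ =>
    ⟨hmem σ, fun h => by have := hmem' _ h; rwa [map_map_symm] at this⟩
  -- Simplices of value `⊤` enter no sublevel complex. As `c` is finite they correspond under `e`,
  -- so both functions are real-valued on `L`.
  set L := X.finitePart
  have htop : ∀ σ ∈ X.complex, Y.value (σ.map e.toEmbedding) ≠ ⊤ ↔ X.value σ ≠ ⊤ := fun σ hσ =>
    ⟨fun h => ne_top_of_le_ne_top (EReal.add_ne_top h (EReal.coe_ne_top _)) (hYX' σ hσ),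
      fun h => ne_top_of_le_ne_top (EReal.add_ne_top h (EReal.coe_ne_top _)) (hXY σ hσ)⟩
  have hcX : ∀ σ ∈ L, ((X.value σ).toReal : EReal) = X.value σ := fun σ hσ =>
    EReal.coe_toReal hσ.2 (X.value_ne_bot hX hσ.1)
  have hcY : ∀ σ ∈ L, ((Y.value (σ.map e.toEmbedding)).toReal : EReal)
      = Y.value (σ.map e.toEmbedding) := fun σ hσ =>
    EReal.coe_toReal ((htop σ hσ.1).2 hσ.2) (Y.value_ne_bot hY (hmem σ hσ.1))
  have hg : MonoOn L fun σ => (X.value σ).toReal := fun σ hσ τ hτ h => by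
    rw [← EReal.coe_le_coe_iff, hcX σ hσ, hcX τ hτ]
    exact X.mono σ hσ.1 τ hτ.1 h
  have hg' : MonoOn L fun σ => (Y.value (σ.map e.toEmbedding)).toReal := fun σ hσ τ hτ h => by
    rw [← EReal.coe_le_coe_iff, hcY σ hσ, hcY τ hτ]
    exact Y.mono _ (hmem σ hσ.1) _ (hmem τ hτ.1) (Finset.map_subset_map.2 h)
  have key := matched_realFiltered (F := F) hg hg' hc (fun σ hσ => by
    have h1 := hXY σ hσ.1
    have h2 := hYX' σ hσ.1
    rw [← hcX σ hσ, ← hcY σ hσ, ← EReal.coe_add, EReal.coe_le_coe_iff] at h1 h2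
    exact abs_le.2 ⟨by linarith, by linarith⟩) r
  rw [pbn_eq_of_equiv (realFiltered L _ hg) X (Equiv.refl V) (fun u σ => ?_) r,
    pbn_eq_of_equiv (realFiltered L _ hg') Y e (fun u σ => ?_) r] at key
  · exact key
  · rw [mem_sublevel_realFiltered]
    constructor
    · rintro ⟨hσ, h⟩
      refine ⟨hmem σ hσ.1, ?_⟩
      rw [← hcY σ hσ]
      exact EReal.coe_le_coe_iff.2 h
    · rintro ⟨hσ, h⟩
      have hσX := (hiff σ).2 hσ
      have hσL : σ ∈ L := ⟨hσX, (htop σ hσX).1 (lt_of_le_of_lt h (EReal.coe_lt_top u)).ne⟩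
      refine ⟨hσL, ?_⟩
      rwa [← hcY σ hσL, EReal.coe_le_coe_iff] at h
  · rw [mem_sublevel_realFiltered, Equiv.refl_toEmbedding, Finset.map_refl]
    constructor
    · rintro ⟨hσ, h⟩
      refine ⟨hσ.1, ?_⟩
      rw [← hcX σ hσ]
      exact EReal.coe_le_coe_iff.2 h
    · rintro ⟨hσ, h⟩
      have hσL : σ ∈ L := ⟨hσ, (lt_of_le_of_lt h (EReal.coe_lt_top u)).ne⟩
      refine ⟨hσL, ?_⟩
      rwa [← hcX σ hσL, EReal.coe_le_coe_iff] at h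

end Transport

/-! ### Weighted graphs -/

section Graph

variable {V V' : Type*} {G : SimpleGraph V} {G' : SimpleGraph V'} (ψ : G ≃g G')

theorem image_closedNeighborhood_subset {H : G.Subgraph} {H' : G'.Subgraph}
    (hadj : ∀ u v, H.Adj u v → H'.Adj (ψ u) (ψ v)) (v : V) :
    ψ '' closedNeighborhood H v ⊆ closedNeighborhood H' (ψ v) := by
  rintro _ ⟨w, rfl | hw, rfl⟩
  · exact Set.mem_insert _ _
  · exact Set.mem_insert_of_mem _ (hadj _ _ hw)

theorem InNeighborhood.image {H : G.Subgraph} {H' : G'.Subgraph}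
    (hverts : ∀ v ∈ H.verts, ψ v ∈ H'.verts) (hadj : ∀ u v, H.Adj u v → H'.Adj (ψ u) (ψ v))
    {S : Set V} (h : InNeighborhood H S) : InNeighborhood H' (ψ '' S) := by
  obtain ⟨w, hw, hS⟩ := h
  exact ⟨ψ w, hverts w hw,
    (Set.image_mono hS).trans (image_closedNeighborhood_subset ψ hadj w)⟩

/-- Extra edges in `H'` only enlarge neighborhoods, so a set containing none of its members'
neighborhoods keeps that property. -/
theorem IsEnclaveless.image {H : G.Subgraph} {H' : G'.Subgraph}
    (hverts : ∀ v ∈ H.verts, ψ v ∈ H'.verts) (hadj : ∀ u v, H.Adj u v → H'.Adj (ψ u) (ψ v))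
    {S : Set V} (h : IsEnclaveless H S) : IsEnclaveless H' (ψ '' S) := by
  refine ⟨?_, ?_⟩
  · rintro _ ⟨v, hv, rfl⟩
    exact hverts v (h.1 hv)
  · rintro _ ⟨v, hv, rfl⟩ hN
    exact h.2 v hv ((Set.image_subset_image_iff ψ.injective).1
      ((image_closedNeighborhood_subset ψ hadj v).trans hN))

theorem coe_map_iso (σ : Finset V) : ((σ.map ψ.toEquiv.toEmbedding : Finset V') : Set V') = ψ '' σ :=
  Finset.coe_map _ _

theorem map_mem_cliqueComplex {σ : Finset V} (h : σ ∈ cliqueComplex G) :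
    σ.map ψ.toEquiv.toEmbedding ∈ cliqueComplex G' := by
  refine ⟨h.1.map, ?_⟩
  rw [coe_map_iso]
  rintro _ ⟨u, hu, rfl⟩ _ ⟨v, hv, rfl⟩ huv
  exact ψ.map_adj_iff.2 (h.2 hu hv fun h => huv (h ▸ rfl))

theorem map_mem_neighborhoodComplex {σ : Finset V} (h : σ ∈ neighborhoodComplex G) :
    σ.map ψ.toEquiv.toEmbedding ∈ neighborhoodComplex G' := by
  refine ⟨h.1.map, ?_⟩
  rw [coe_map_iso]
  exact h.2.image ψ (H' := (⊤ : G'.Subgraph)) (fun _ _ => trivial) fun _ _ => ψ.map_adj_iff.2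

theorem map_mem_enclavelessComplex {σ : Finset V} (h : σ ∈ enclavelessComplex G) :
    σ.map ψ.toEquiv.toEmbedding ∈ enclavelessComplex G' := by
  refine ⟨h.1.map, ?_⟩
  rw [coe_map_iso]
  exact h.2.image ψ (H' := (⊤ : G'.Subgraph)) (fun _ _ => trivial) fun _ _ => ψ.map_adj_iff.2

theorem simplexValue_singleton (f : G.edgeSet → ℝ) (g : Finset V → EReal) (v : V) :
    simplexValue G f g {v} = vertexValue G f v := by
  simp [simplexValue]

theorem vertexValue_ne_bot [Finite V] (f : G.edgeSet → ℝ) (v : V) : vertexValue G f v ≠ ⊥ := by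
  obtain ⟨m, hm⟩ := (Set.finite_range f).bddBelow
  refine ne_bot_of_le_ne_bot (EReal.coe_ne_bot m) (le_iInf₂ fun e _ => ?_)
  exact EReal.coe_le_coe_iff.2 (hm ⟨e, rfl⟩)

theorem cliqueValue_singleton_ne_bot [Finite V] (f : G.edgeSet → ℝ) (v : V) :
    cliqueValue G f {v} ≠ ⊥ := by
  rw [cliqueValue, simplexValue_singleton]
  exact vertexValue_ne_bot f v

theorem neighborhoodValue_singleton_ne_bot [Finite V] (f : G.edgeSet → ℝ) (v : V) :
    neighborhoodValue G f {v} ≠ ⊥ := by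
  rw [neighborhoodValue, simplexValue_singleton]
  exact vertexValue_ne_bot f v

theorem enclavelessValue_singleton_ne_bot [Finite V] (f : G.edgeSet → ℝ) (v : V) :
    enclavelessValue G f {v} ≠ ⊥ := by
  rw [enclavelessValue, simplexValue_singleton]
  exact vertexValue_ne_bot f v

variable {f : G.edgeSet → ℝ} {f' : G'.edgeSet → ℝ} {c : ℝ}

theorem mem_mapEdgeSet_iff {e : G.edgeSet} {v : V} : ψ v ∈ (ψ.mapEdgeSet e).1 ↔ v ∈ e.1 := by
  change ψ v ∈ Sym2.map ψ e.1 ↔ _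
  rw [Sym2.mem_map]
  exact ⟨fun ⟨w, hw, h⟩ => ψ.injective h ▸ hw, fun h => ⟨v, h, rfl⟩⟩

theorem map_mem_verts_sublevelGraph (hf : ∀ e, f' (ψ.mapEdgeSet e) ≤ f e + c) {t : ℝ} {v : V}
    (h : v ∈ (sublevelGraph G f t).verts) : ψ v ∈ (sublevelGraph G' f' (t + c)).verts := by
  obtain ⟨e, he, hv⟩ := h
  exact ⟨ψ.mapEdgeSet e, (hf e).trans (by linarith), (mem_mapEdgeSet_iff ψ).2 hv⟩

theorem map_adj_sublevelGraph (hf : ∀ e, f' (ψ.mapEdgeSet e) ≤ f e + c) {t : ℝ} {u v : V}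
    (h : (sublevelGraph G f t).Adj u v) : (sublevelGraph G' f' (t + c)).Adj (ψ u) (ψ v) := by
  obtain ⟨huv, ht⟩ := h
  exact ⟨ψ.map_adj_iff.2 huv, (hf ⟨s(u, v), huv⟩).trans (by linarith)⟩

theorem vertexValue_map_le (hf : ∀ e, f' (ψ.mapEdgeSet e) ≤ f e + c) (v : V) :
    vertexValue G' f' (ψ v) ≤ vertexValue G f v + (c : EReal) := by
  rw [← EReal.sub_le_iff_le_add (by simp) (by simp)]
  refine le_iInf₂ fun e he => ?_
  rw [EReal.sub_le_iff_le_add (by simp) (by simp), ← EReal.coe_add]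
  exact (vertexValue_le _ ((mem_mapEdgeSet_iff ψ).2 he)).trans (EReal.coe_le_coe_iff.2 (hf e))

theorem simplexValue_map_le (hf : ∀ e, f' (ψ.mapEdgeSet e) ≤ f e + c) {g : Finset V → EReal}
    {g' : Finset V' → EReal} {σ : Finset V}
    (hg : g' (σ.map ψ.toEquiv.toEmbedding) ≤ g σ + (c : EReal)) :
    simplexValue G' f' g' (σ.map ψ.toEquiv.toEmbedding) ≤ simplexValue G f g σ + (c : EReal) := by
  by_cases h : σ.card = 1
  · obtain ⟨v, rfl⟩ := Finset.card_eq_one.1 h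
    rw [Finset.map_singleton, simplexValue_singleton, simplexValue_singleton]
    exact vertexValue_map_le ψ hf v
  · rwa [simplexValue, simplexValue, Finset.card_map, if_neg h, if_neg h]

theorem cliqueValue_map_le (hf : ∀ e, f' (ψ.mapEdgeSet e) ≤ f e + c) (σ : Finset V) :
    cliqueValue G' f' (σ.map ψ.toEquiv.toEmbedding) ≤ cliqueValue G f σ + (c : EReal) := by
  refine simplexValue_map_le ψ hf (iSup₂_le fun e he => ?_)
  obtain ⟨e, rfl⟩ := ψ.mapEdgeSet.surjective e
  refine (EReal.coe_le_coe_iff.2 (hf e)).trans ?_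
  rw [EReal.coe_add]
  refine add_le_add_left (le_iSup₂_of_le (f := fun (e : G.edgeSet) (_ : ∀ v ∈ e.1, v ∈ σ) =>
    (f e : EReal)) e (fun v hv => ?_) le_rfl) _
  obtain ⟨w, hw, h⟩ := Finset.mem_map.1 (he _ ((mem_mapEdgeSet_iff ψ).2 hv))
  exact ψ.injective h ▸ hw

/-- Shifting admissible thresholds by `c` shifts their infimum by at most `c`; used for both
neighborhoods and enclaveless sets. -/
theorem iInf_real_le_add {P P' : ℝ → Prop} (h : ∀ t, P t → P' (t + c)) :
    ⨅ (t : ℝ) (_ : P' t), (t : EReal) ≤ (⨅ (t : ℝ) (_ : P t), (t : EReal)) + (c : EReal) := by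
  rw [← EReal.sub_le_iff_le_add (by simp) (by simp)]
  refine le_iInf₂ fun t ht => ?_
  rw [EReal.sub_le_iff_le_add (by simp) (by simp), ← EReal.coe_add]
  exact iInf₂_le (t + c) (h t ht)

theorem neighborhoodValue_map_le (hf : ∀ e, f' (ψ.mapEdgeSet e) ≤ f e + c) (σ : Finset V) :
    neighborhoodValue G' f' (σ.map ψ.toEquiv.toEmbedding)
      ≤ neighborhoodValue G f σ + (c : EReal) := by
  refine simplexValue_map_le ψ hf (iInf_real_le_add fun t ht => ?_)
  rw [coe_map_iso]
  exact ht.image ψ (fun _ => map_mem_verts_sublevelGraph ψ hf)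
    fun _ _ => map_adj_sublevelGraph ψ hf

theorem enclavelessValue_map_le (hf : ∀ e, f' (ψ.mapEdgeSet e) ≤ f e + c) (σ : Finset V) :
    enclavelessValue G' f' (σ.map ψ.toEquiv.toEmbedding)
      ≤ enclavelessValue G f σ + (c : EReal) := by
  refine simplexValue_map_le ψ hf (iInf_real_le_add fun t ⟨S, hS, h⟩ => ?_)
  rw [coe_map_iso]
  exact ⟨ψ '' S, Set.image_mono hS, h.image ψ (fun _ => map_mem_verts_sublevelGraph ψ hf)
    fun _ _ => map_adj_sublevelGraph ψ hf⟩

theorem exists_real_bound [Finite V] (ψ : G ≃g G') (f : G.edgeSet → ℝ) (f' : G'.edgeSet → ℝ) :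
    ∃ c : ℝ, 0 ≤ c ∧ ENNReal.ofReal c = ⨆ e, ENNReal.ofReal |f e - f' (ψ.mapEdgeSet e)| ∧
      ∀ e, |f e - f' (ψ.mapEdgeSet e)| ≤ c := by
  have hfin : (⨆ e, ENNReal.ofReal |f e - f' (ψ.mapEdgeSet e)|) ≠ ⊤ := by
    obtain ⟨m, hm⟩ := (Set.finite_range fun e => |f e - f' (ψ.mapEdgeSet e)|).bddAbove
    exact ne_top_of_le_ne_top ENNReal.ofReal_ne_top
      (iSup_le fun e => ENNReal.ofReal_le_ofReal (hm ⟨e, rfl⟩))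
  refine ⟨_, ENNReal.toReal_nonneg, ENNReal.ofReal_toReal hfin, fun e => ?_⟩
  exact (ENNReal.ofReal_le_iff_le_toReal hfin).1
    (le_iSup (fun e => ENNReal.ofReal |f e - f' (ψ.mapEdgeSet e)|) e)

theorem le_add_symm_of_abs_le (h : ∀ e, |f e - f' (ψ.mapEdgeSet e)| ≤ c) (e : G'.edgeSet) :
    f (ψ.symm.mapEdgeSet e) ≤ f' e + c := by
  obtain ⟨e, rfl⟩ := ψ.mapEdgeSet.surjective e
  have : ψ.symm.mapEdgeSet (ψ.mapEdgeSet e) = e := ψ.mapEdgeSet.symm_apply_apply e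
  rw [this]
  linarith [abs_le.1 (h e)]

end Graph

end GraphPersistence
end

open GraphPersistence in
theorem mainTheorem2 {F : Type*} [Field F] {V V' : Type*} [Finite V] [Finite V']
    (G : SimpleGraph V) (f : G.edgeSet → ℝ) (G' : SimpleGraph V') (f' : G'.edgeSet → ℝ) (r : ℕ) :
    GraphPersistence.bottleneckDist
        (GraphPersistence.pbn F (GraphPersistence.cliqueFiltered G f) r)
        (GraphPersistence.pbn F (GraphPersistence.cliqueFiltered G' f') r)
      ≤ GraphPersistence.naturalPseudodist G f G' f' ∧
    GraphPersistence.bottleneckDist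
        (GraphPersistence.pbn F (GraphPersistence.neighborhoodFiltered G f) r)
        (GraphPersistence.pbn F (GraphPersistence.neighborhoodFiltered G' f') r)
      ≤ GraphPersistence.naturalPseudodist G f G' f' ∧
    GraphPersistence.bottleneckDist
        (GraphPersistence.pbn F (GraphPersistence.enclavelessFiltered G f) r)
        (GraphPersistence.pbn F (GraphPersistence.enclavelessFiltered G' f') r)
      ≤ GraphPersistence.naturalPseudodist G f G' f' := by
  -- The bound is proved for each isomorphism; if there is none, the infimum is `⊤`.
  refine ⟨le_iInf fun ψ => ?_, le_iInf fun ψ => ?_, le_iInf fun ψ => ?_⟩ <;>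
    obtain ⟨c, hc, hsup, hle⟩ := exists_real_bound ψ f f' <;>
    have h1 : ∀ e, f' (ψ.mapEdgeSet e) ≤ f e + c := (fun e => by linarith [abs_le.1 (hle e)]) <;>
    have h2 := le_add_symm_of_abs_le ψ hle <;>
    rw [← hsup]
  · exact (matched_of_equiv (cliqueFiltered G f) (cliqueFiltered G' f') ψ.toEquiv
      (fun σ => map_mem_cliqueComplex ψ) (fun σ => map_mem_cliqueComplex ψ.symm)
      (cliqueValue_singleton_ne_bot f)
      (cliqueValue_singleton_ne_bot f') hc (fun σ _ => cliqueValue_map_le ψ h1 σ)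
      (fun σ _ => cliqueValue_map_le ψ.symm h2 σ) r).bottleneckDist_le
  · exact (matched_of_equiv (neighborhoodFiltered G f) (neighborhoodFiltered G' f') ψ.toEquiv
      (fun σ => map_mem_neighborhoodComplex ψ) (fun σ => map_mem_neighborhoodComplex ψ.symm)
      (neighborhoodValue_singleton_ne_bot f)
      (neighborhoodValue_singleton_ne_bot f') hc (fun σ _ => neighborhoodValue_map_le ψ h1 σ)
      (fun σ _ => neighborhoodValue_map_le ψ.symm h2 σ) r).bottleneckDist_le
  · exact (matched_of_equiv (enclavelessFiltered G f) (enclavelessFiltered G' f') ψ.toEquiv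
      (fun σ => map_mem_enclavelessComplex ψ) (fun σ => map_mem_enclavelessComplex ψ.symm)
      (enclavelessValue_singleton_ne_bot f)
      (enclavelessValue_singleton_ne_bot f') hc (fun σ _ => enclavelessValue_map_le ψ h1 σ)
      (fun σ _ => enclavelessValue_map_le ψ.symm h2 σ) r).bottleneckDist_le
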